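/- A *Lehmer pair* is a pair $(\alpha,\beta)$ of algebraic integers such that $(\alpha+\beta)^2$ and $\alpha\beta$ are non-zero coprime rational integers and $\alpha/\beta$ is not a root of unity. Put $\tilde u_n=\frac{\alpha^n-\beta^n}{\alpha-\beta}$ for $n$ odd and $\tilde u_n=\frac{\alpha^n-\beta^n}{\alpha^2-\beta^2}$ for $n$ even. The pair is *$n$-defective* if no prime divides $\tilde u_n$ without dividing $(\alpha^2-\beta^2)^2\tilde u_1\cdots\tilde u_{n-1}$. Two pairs are *equivalent* if $\alpha_1/\alpha_2=\beta_1/\beta_2\in\{\pm1,\pm\sqrt{-1}\}$. Define sequences of integers by - $\phi_{k+2}=\phi_{k+1}+\phi_k$ for $k\ge-2$, with $\phi_{-2}=-1$, $\phi_{-1}=1$; - $\psi_{k+2}=\psi_{k+1}+\psi_k$ for $k\ge-2$, with $\psi_{-2}=3$, $\psi_{-1}=-1$; - $\pi_{k+1}=2\pi_k+\pi_{k-1}$ for $k\ge0$, with $\pi_{-1}=1$, $\pi_0=0$; - $\rho_{k+1}=2\rho_k+\rho_{k-1}$ for $k\ge0$, with $\rho_{-1}=-1$, $\rho_0=1$;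 - $\zeta^{(i)}_{k+1}=4\zeta^{(i)}_k-\zeta^{(i)}_{k-1}$ for $k\ge0$, with $(\zeta^{(i)}_{-1},\zeta^{(i)}_0)=(-1,0),(2,1),(1,1),(-1,1)$ for $i=0,1,2,3$, respectively. Consider the following table of pairs $(a,b)$, in which $k,\ell,q\in\mathbb Z$ and $\varepsilon=\pm1$. - $n=3$: $(1+q,\,1-3q)$ with $q\notin\{-1,0,1\}$; $(3^k+q,\,3^k-3q)$ with $k>0$, $3\nmid q$, $(k,q)\ne(1,1)$. - $n=4$: $(1+2q,\,1-2q)$ with $q\notin\{-1,0,1\}$; $(2^k+2q,\,2^k-2q)$ with $k>0$, $2\nmid q$, $(k,q)\notin\{(1,-1),(1,1)\}$. - $n=5$: $(\phi_{k-2\varepsilon},\,\phi_{k-2\varepsilon}-4\phi_k)$ with $k\ge3$; $(\psi_{k-2\varepsilon},\,\psi_{k-2\varepsilon}-4\psi_k)$ with $k\ge0$, $(k,\varepsilon)\notin\{(0,-1),(1,-1)\}$. - $n=6$: $(1+3q,\,1-q)$ with $q\notin\{-1,0,1\}$; $(3^\ell+3q,\,3^\ell-q)$ with $\ell>0$, $3\nmid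 q$, $(\ell,q)\ne(1,-1)$; $(2^k+3q,\,2^k-q)$ with $k>0$, $2\nmid q$, $(k,q)\ne(1,-1)$; $(2^k3^\ell+3q,\,2^k3^\ell-q)$ with $k,\ell>0$, $\gcd(6,q)=1$. - $n=8$: $(\rho_{k-\varepsilon},\,\rho_{k-\varepsilon}-4\pi_k)$ with $k\ge2$; $(2\pi_{k-\varepsilon},\,2\pi_{k-\varepsilon}-4\rho_k)$ with $k\ge2$. - $n=10$: $(\phi_{k-2\varepsilon}-4\phi_k,\,\phi_{k-2\varepsilon})$ with $k\ge3$; $(\psi_{k-2\varepsilon}-4\psi_k,\,\psi_{k-2\varepsilon})$ with $k\ge0$, $(k,\varepsilon)\notin\{(0,-1),(1,-1)\}$. - $n=12$: $(\zeta^{(i)}_{k-\varepsilon},\,-\zeta^{(i)}_{k+\varepsilon})$ with $i\in\{0,1,2,3\}$, $k\ge0$, $(i,k)\notin\{(0,0),(0,1),(1,0),(2,0)\}$. **Theorem.** Let $n\in\{3,4,5,6,8,10,12\}$. Here $\sqrt a$ and $\sqrt b$ stand for arbitrary complex square roots of $a$ and $b$. 1. Every $n$-defective Lehmer pair is equivalent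 to a pair $\left(\frac{\sqrt a-\sqrt b}{2},\frac{\sqrt a+\sqrt b}{2}\right)$ with $(a,b)$ in the table for $n$ (for some choice of the square roots). 2. Conversely, for every $(a,b)$ in the table for $n$ and every choice of the square roots, this pair is an $n$-defective Lehmer pair. 3. Pairs arising from two distinct entries of the table for $n$ (different families, or different parameters in one family) are never equivalent. -/

import Mathlib

namespace LehmerDefective

/-- A Lehmer pair: algebraic integers `α, β` (taken in `ℂ`) such that `(α + β)²` and `αβ` are
non-zero coprime rational integers and `α / β` is not a root of unity. -/
def IsLehmerPair (α β : ℂ) : Prop :=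
  IsIntegral ℤ α ∧ IsIntegral ℤ β ∧
  (∃ p q : ℤ, p ≠ 0 ∧ q ≠ 0 ∧ IsCoprime p q ∧ (α + β) ^ 2 = (p : ℂ) ∧ α * β = (q : ℂ)) ∧
  ∀ m : ℕ, 0 < m → (α / β) ^ m ≠ 1

/-- The `n`-th Lehmer number of `(α, β)`. (Its denominator is non-zero for a Lehmer pair.) -/
noncomputable def lehmerNumber (α β : ℂ) (n : ℕ) : ℂ :=
  if Odd n then (α ^ n - β ^ n) / (α - β) else (α ^ n - β ^ n) / (α ^ 2 - β ^ 2)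

/-- The natural number `m` divides the complex number `z` (which is a rational integer in all uses
below) in the ring of rational integers. -/
def DividesInt (m : ℕ) (z : ℂ) : Prop :=
  ∃ t : ℤ, z = (m : ℂ) * (t : ℂ)

/-- The prime `r` divides the `n`-th Lehmer number of `(α, β)` but does not divide the product of
`(α² - β²)²` with the Lehmer numbers of index `1, …, n - 1`. -/
def IsPrimitiveDivisor (α β : ℂ) (n r : ℕ) : Prop :=
  r.Prime ∧ DividesInt r (lehmerNumber α β n) ∧
  ¬ DividesInt r ((α ^ 2 - β ^ 2) ^ 2 * ∏ j ∈ Finset.Ico 1 n, lehmerNumber α β j)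

/-- `(α, β)` is an `n`-defective Lehmer pair. -/
def IsDefectiveLehmerPair (n : ℕ) (α β : ℂ) : Prop :=
  IsLehmerPair α β ∧ ∀ r : ℕ, ¬ IsPrimitiveDivisor α β n r

/-- Equivalence of pairs: `α₁ / α₂ = β₁ / β₂ ∈ {1, -1, √-1, -√-1}`. -/
def PairEquiv (α₁ β₁ α₂ β₂ : ℂ) : Prop :=
  α₁ / α₂ = β₁ / β₂ ∧ α₁ / α₂ ∈ ({1, -1, Complex.I, -Complex.I} : Set ℂ)

/-- `(α, β) = ((√a - √b) / 2, (√a + √b) / 2)` for some choice `s`, `t` of the complex square roots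
`√a` and `√b`. -/
def IsPairOf (a b : ℤ) (α β : ℂ) : Prop :=
  ∃ s t : ℂ, s ^ 2 = (a : ℂ) ∧ t ^ 2 = (b : ℂ) ∧ α = (s - t) / 2 ∧ β = (s + t) / 2

/-- The sequence `x 0 = s`, `x 1 = t`, `x (m + 2) = c * x (m + 1) + d * x m`. -/
def binRec (c d s t : ℤ) : ℕ → ℤ
  | 0 => s
  | 1 => t
  | m + 2 => c * binRec c d s t (m + 1) + d * binRec c d s t m

/-- The Fibonacci numbers `φ_k`, for `k ≥ -2`: `φ_{-2} = -1`, `φ_{-1} = 1`, `φ_0 = 0`, `φ_1 = 1`. -/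
def phi (k : ℤ) : ℤ := binRec 1 1 (-1) 1 (k + 2).toNat

/-- The classical Lucas numbers `ψ_k`, for `k ≥ -2`:
`ψ_{-2} = 3`, `ψ_{-1} = -1`, `ψ_0 = 2`, `ψ_1 = 1`. -/
def psi (k : ℤ) : ℤ := binRec 1 1 3 (-1) (k + 2).toNat

/-- The sequence `π_{k+1} = 2 π_k + π_{k-1}`, for `k ≥ -1`: `π_{-1} = 1`, `π_0 = 0`, `π_1 = 1`. -/
def pell (k : ℤ) : ℤ := binRec 2 1 1 0 (k + 1).toNat

/-- The sequence `ρ_{k+1} = 2 ρ_k + ρ_{k-1}`, for `k ≥ -1`: `ρ_{-1} = -1`, `ρ_0 = ρ_1 = 1`. -/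
def rho (k : ℤ) : ℤ := binRec 2 1 (-1) 1 (k + 1).toNat

/-- The four sequences `ζ⁽ⁱ⁾_{k+1} = 4 ζ⁽ⁱ⁾_k - ζ⁽ⁱ⁾_{k-1}`, for `k ≥ -1`, with
`(ζ⁽ⁱ⁾_{-1}, ζ⁽ⁱ⁾_0) = (-1, 0), (2, 1), (1, 1), (-1, 1)` for `i = 0, 1, 2, 3`. -/
def zeta (i : Fin 4) (k : ℤ) : ℤ :=
  binRec 4 (-1) ((![-1, 2, 1, -1] : Fin 4 → ℤ) i) ((![0, 1, 1, 1] : Fin 4 → ℤ) i) (k + 1).toNat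

/-- The entries of the table for a given `n`: a family together with admissible parameters. -/
inductive Entry : ℕ → Type
  | three₁ (q : ℤ) (h : q ≠ -1 ∧ q ≠ 0 ∧ q ≠ 1) : Entry 3
  | three₂ (k : ℕ) (q : ℤ) (hk : 0 < k) (hq : ¬ (3 : ℤ) ∣ q) (h : (k, q) ≠ (1, 1)) : Entry 3
  | four₁ (q : ℤ) (h : q ≠ -1 ∧ q ≠ 0 ∧ q ≠ 1) : Entry 4
  | four₂ (k : ℕ) (q : ℤ) (hk : 0 < k) (hq : ¬ (2 : ℤ) ∣ q)
      (h : (k, q) ≠ (1, -1) ∧ (k, q) ≠ (1, 1)) : Entry 4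
  | five₁ (k : ℕ) (ε : ℤ) (hε : ε = 1 ∨ ε = -1) (hk : 3 ≤ k) : Entry 5
  | five₂ (k : ℕ) (ε : ℤ) (hε : ε = 1 ∨ ε = -1)
      (h : (k, ε) ≠ (0, -1) ∧ (k, ε) ≠ (1, -1)) : Entry 5
  | six₁ (q : ℤ) (h : q ≠ -1 ∧ q ≠ 0 ∧ q ≠ 1) : Entry 6
  | six₂ (l : ℕ) (q : ℤ) (hl : 0 < l) (hq : ¬ (3 : ℤ) ∣ q) (h : (l, q) ≠ (1, -1)) : Entry 6
  | six₃ (k : ℕ) (q : ℤ) (hk : 0 < k) (hq : ¬ (2 : ℤ) ∣ q) (h : (k, q) ≠ (1, -1)) : Entry 6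
  | six₄ (k l : ℕ) (q : ℤ) (hk : 0 < k) (hl : 0 < l) (hq : IsCoprime 6 q) : Entry 6
  | eight₁ (k : ℕ) (ε : ℤ) (hε : ε = 1 ∨ ε = -1) (hk : 2 ≤ k) : Entry 8
  | eight₂ (k : ℕ) (ε : ℤ) (hε : ε = 1 ∨ ε = -1) (hk : 2 ≤ k) : Entry 8
  | ten₁ (k : ℕ) (ε : ℤ) (hε : ε = 1 ∨ ε = -1) (hk : 3 ≤ k) : Entry 10
  | ten₂ (k : ℕ) (ε : ℤ) (hε : ε = 1 ∨ ε = -1)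
      (h : (k, ε) ≠ (0, -1) ∧ (k, ε) ≠ (1, -1)) : Entry 10
  | twelve (i : Fin 4) (k : ℕ) (ε : ℤ) (hε : ε = 1 ∨ ε = -1)
      (h : (i, k) ≠ (0, 0) ∧ (i, k) ≠ (0, 1) ∧ (i, k) ≠ (1, 0) ∧ (i, k) ≠ (2, 0)) : Entry 12

/-- The pair `(a, b)` of a table entry. -/
def Entry.ab : {n : ℕ} → Entry n → ℤ × ℤ
  | _, .three₁ q _ => (1 + q, 1 - 3 * q)
  | _, .three₂ k q _ _ _ => (3 ^ k + q, 3 ^ k - 3 * q)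
  | _, .four₁ q _ => (1 + 2 * q, 1 - 2 * q)
  | _, .four₂ k q _ _ _ => (2 ^ k + 2 * q, 2 ^ k - 2 * q)
  | _, .five₁ k ε _ _ => (phi (k - 2 * ε), phi (k - 2 * ε) - 4 * phi k)
  | _, .five₂ k ε _ _ => (psi (k - 2 * ε), psi (k - 2 * ε) - 4 * psi k)
  | _, .six₁ q _ => (1 + 3 * q, 1 - q)
  | _, .six₂ l q _ _ _ => (3 ^ l + 3 * q, 3 ^ l - q)
  | _, .six₃ k q _ _ _ => (2 ^ k + 3 * q, 2 ^ k - q)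
  | _, .six₄ k l q _ _ _ => (2 ^ k * 3 ^ l + 3 * q, 2 ^ k * 3 ^ l - q)
  | _, .eight₁ k ε _ _ => (rho (k - ε), rho (k - ε) - 4 * pell k)
  | _, .eight₂ k ε _ _ => (2 * pell (k - ε), 2 * pell (k - ε) - 4 * rho k)
  | _, .ten₁ k ε _ _ => (phi (k - 2 * ε) - 4 * phi k, phi (k - 2 * ε))
  | _, .ten₂ k ε _ _ => (psi (k - 2 * ε) - 4 * psi k, psi (k - 2 * ε))
  | _, .twelve i k ε _ _ => (zeta i (k - ε), -zeta i (k + ε))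

end LehmerDefective

/-!
Put `p = (α + β)²` and `q = αβ`. Replacing `(α, β)` by an equivalent pair changes `(p, q)` at most
by a common sign, and `(p, q)` determines the pair up to `±1` and up to the order of `α`, `β`, which
a choice of square roots absorbs. So the theorem is about pairs of integers
(`classification_of_integers`). They come from a Lehmer pair exactly when they are coprime, non-zero
and `p / q ∉ {1, 2, 3, 4}`: if `α / β` is a root of unity, then `p / q = α / β + β / α + 2` is an
algebraic integer, rational and in `[0, 4]` (`Nondegenerate.isLehmerPair`).

Let `Φₙ(p, q)` be the homogenized `n`-th cyclotomic polynomial at `(α, β)`. If a prime `r ∤ n`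
divides `Φₙ(p, q)`, then `α / β` has order exactly `n` in an algebraic closure of `ℤ/r`, so `r` is a
primitive divisor (`not_dvd_lehmerInt`); the finitely many facts this needs about `r` are resultant
identities. A prime dividing both `n` and `Φₙ(p, q)` is not primitive. Hence the pair is
`n`-defective iff every prime factor of `Φₙ(p, q)` divides `n` (`noPrimitivePrime_iff`). For
`n = 5, 8, 10, 12` such a prime divides `Φₙ(p, q)` only once.

For `n = 3, 4, 6` the form `Φₙ` is linear, namely `p - q`, `p - 2 q`, `p - 3 q`, and it has to be,
up to sign, a power of `3`, a power of `2`, or a product `2ᵏ 3ˡ`. For `n = 5, 8, 12` it is an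
indefinite binary quadratic form of discriminant `5`, `8`, `12` which has to divide `5`, `2`, `6`.
These Pell equations are solved by descent (`exists_phi`, `exists_psi`, `exists_pell`,
`exists_zeta`); the two solutions `p` for a given `q` are exchanged by `p ↦ 3 q - p` or
`p ↦ 4 q - p`, which is the sign `ε` of the table. The case `n = 10` is the case `n = 5` for
`(α, -β)`, that is, for `(p - 4 q, -q)`.

In every family the value of `Φₙ(p, q)` together with `q` determines the parameters apart from `ε`,
and `p` determines `ε`; this gives inequivalence. The common sign is fixed by the sign of `Φₙ(p, q)`
for `n = 3, 4, 6` and by that of `q` otherwise.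
-/

namespace LehmerDefective

/-! ### Lehmer pairs and their integer invariants -/

/-- The `n`-th Lehmer number as an integer polynomial in `p = (α + β)²` and `q = αβ`, by a recursion
whose coefficient alternates because `α + β` itself is only a square root of `p`. -/
def lehmerInt (p q : ℤ) : ℕ → ℤ
  | 0 => 0
  | 1 => 1
  | n + 2 => (if Even n then 1 else p) * lehmerInt p q (n + 1) - q * lehmerInt p q n

/-- Binet's formula, over any commutative ring containing suitable `x`, `y`. -/
theorem lehmerInt_binet {K : Type*} [CommRing K] {p q : ℤ} {x y : K} (hp : (x + y) ^ 2 = (p : K))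
    (hq : x * y = (q : K)) (n : ℕ) :
    (x - y) * (if Even n then x + y else 1) * (lehmerInt p q n : K) = x ^ n - y ^ n := by
  induction n using Nat.twoStepInduction with
  | zero => simp [lehmerInt]
  | one => simp [lehmerInt]
  | more n ih₁ ih₂ =>
    have step : x ^ (n + 2) - y ^ (n + 2) =
        (x + y) * (x ^ (n + 1) - y ^ (n + 1)) - x * y * (x ^ n - y ^ n) := by ring
    rw [step, ← ih₁, ← ih₂, hq]
    rcases Nat.even_or_odd n with h | h
    · have h1 : ¬ Even (n + 1) := by simpa [Nat.even_add_one] using h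
      have h2 : Even (n + 2) := by simpa [Nat.even_add] using h
      simp only [lehmerInt, h, h1, h2, if_true, if_false]
      push_cast
      ring
    · have h0 : ¬ Even n := by simpa using h
      have h1 : Even (n + 1) := by simpa [Nat.even_add_one] using h
      have h2 : ¬ Even (n + 2) := by simpa [Nat.even_add] using h
      simp only [lehmerInt, h0, h1, h2, if_true, if_false]
      push_cast
      rw [← hp]
      ring

/-- The conditions on `p = (α + β)²` and `q = αβ` that make `(α, β)` a Lehmer pair. The last
four say that `α / β` is not a root of unity; they exclude the orders `3`, `4`, `6` and `α = β`. -/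
structure Nondegenerate (p q : ℤ) : Prop where
  coprime : IsCoprime p q
  p_ne : p ≠ 0
  q_ne : q ≠ 0
  ne_one : p ≠ q
  ne_two : p ≠ 2 * q
  ne_three : p ≠ 3 * q
  ne_four : p ≠ 4 * q

theorem IsLehmerPair.nondegenerate {α β : ℂ} {p q : ℤ} (h : IsLehmerPair α β)
    (hp : (α + β) ^ 2 = (p : ℂ)) (hq : α * β = (q : ℂ)) : Nondegenerate p q := by
  obtain ⟨-, -, ⟨p', q', hp0, hq0, hc, hp', hq'⟩, hr⟩ := h
  obtain rfl : p' = p := by exact_mod_cast hp'.symm.trans hp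
  obtain rfl : q' = q := by exact_mod_cast hq'.symm.trans hq
  have hβ : β ≠ 0 := by
    rintro rfl
    apply hq0
    rw [mul_zero] at hq
    exact_mod_cast hq.symm
  have key : ∀ m : ℕ, 0 < m → α ^ m - β ^ m ≠ 0 := by
    intro m hm h
    apply hr m hm
    rw [div_pow, div_eq_one_iff_eq (pow_ne_zero _ hβ)]
    exact sub_eq_zero.mp h
  refine ⟨hc, hp0, hq0, ?_, ?_, ?_, ?_⟩ <;> intro h <;> have h' := congrArg (Int.cast : ℤ → ℂ) h <;>
    push_cast at h' <;> rw [← hp, ← hq] at h'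
  · exact key 3 (by norm_num) (by linear_combination (α - β) * h')
  · exact key 4 (by norm_num) (by linear_combination (α ^ 2 - β ^ 2) * h')
  · exact key 6 (by norm_num) (by linear_combination (α ^ 3 - β ^ 3) * (α + β) * h')
  · have : (α - β) ^ 2 = 0 := by linear_combination h'
    exact key 1 (by norm_num) (by simpa using this)

/-- `α` is a root of `X⁴ - (p - 2 q) X² + q²`. -/
theorem isIntegral_of_sq_add {α β : ℂ} {p q : ℤ} (hp : (α + β) ^ 2 = (p : ℂ))
    (hq : α * β = (q : ℂ)) : IsIntegral ℤ α := by
  refine ⟨Polynomial.X ^ 4 - Polynomial.C (p - 2 * q) * Polynomial.X ^ 2 + Polynomial.C (q ^ 2),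
    by monicity!, ?_⟩
  simp only [← Polynomial.aeval_def, map_add, map_sub, map_mul, map_pow, Polynomial.aeval_X,
    Polynomial.aeval_C]
  simp only [algebraMap_int_eq, eq_intCast, ← hp, ← hq]
  push_cast
  ring

theorem Nondegenerate.isLehmerPair {α β : ℂ} {p q : ℤ} (h : Nondegenerate p q)
    (hp : (α + β) ^ 2 = (p : ℂ)) (hq : α * β = (q : ℂ)) : IsLehmerPair α β := by
  refine ⟨isIntegral_of_sq_add hp hq,
    isIntegral_of_sq_add (by rw [add_comm, hp]) (by rw [mul_comm, hq]),
    ⟨p, q, h.p_ne, h.q_ne, h.coprime, hp, hq⟩, fun m hm hz => ?_⟩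
  have hqC : (q : ℂ) ≠ 0 := by exact_mod_cast h.q_ne
  have hα : α ≠ 0 := by rintro rfl; simp [eq_comm, hqC] at hq
  have hβ : β ≠ 0 := by rintro rfl; simp [eq_comm, hqC] at hq
  set z := α / β with hzdef
  have hz0 : z ≠ 0 := div_ne_zero hα hβ
  have hpq : (p : ℂ) / q = z + z⁻¹ + 2 := by
    rw [← hp, ← hq, hzdef]
    field_simp
    ring
  have hz1 : IsIntegral ℤ z := IsIntegral.of_pow hm (by rw [hz]; exact isIntegral_one)
  have hz2 : IsIntegral ℤ z⁻¹ :=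
    IsIntegral.of_pow hm (by rw [inv_pow, hz, inv_one]; exact isIntegral_one)
  have hint : IsIntegral ℤ ((p : ℚ) / q) := by
    have : IsIntegral ℤ (algebraMap ℚ ℂ ((p : ℚ) / q)) := by
      have e : algebraMap ℚ ℂ ((p : ℚ) / q) = z + z⁻¹ + 2 := by simpa using hpq
      rw [e]
      exact (hz1.add hz2).add (by simpa using isIntegral_algebraMap (R := ℤ) (A := ℂ) (x := 2))
    exact (isIntegral_algebraMap_iff (algebraMap ℚ ℂ).injective).mp this
  obtain ⟨k, hk⟩ := IsIntegrallyClosed.isIntegral_iff.mp hint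
  have hqQ : (q : ℚ) ≠ 0 := by exact_mod_cast h.q_ne
  have hpk : p = k * q := by
    have : (p : ℚ) = k * q := by
      rw [eq_div_iff hqQ] at hk
      simpa using hk.symm
    exact_mod_cast this
  -- `k = z + z⁻¹ + 2 = 2 re z + 2` lies between `0` and `4`, because `|z| = 1`.
  have hnorm : ‖z‖ = 1 := Complex.norm_eq_one_of_pow_eq_one hz hm.ne'
  have hkre : (k : ℝ) = 2 * z.re + 2 := by
    have e : (k : ℂ) = z + z⁻¹ + 2 := by
      rw [← hpq, hpk, Int.cast_mul, mul_div_assoc, div_self hqC, mul_one]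
    rw [Complex.inv_eq_conj hnorm, Complex.add_conj] at e
    exact_mod_cast e
  have hre := abs_le.mp ((Complex.abs_re_le_norm z).trans_eq hnorm)
  have hk0 : 0 ≤ k := by
    have : (0 : ℝ) ≤ k := by linarith [hre.1]
    exact_mod_cast this
  have hk4 : k ≤ 4 := by
    have : (k : ℝ) ≤ 4 := by linarith [hre.2]
    exact_mod_cast this
  interval_cases k
  · exact h.p_ne (by simpa using hpk)
  · exact h.ne_one (by simpa using hpk)
  · exact h.ne_two hpk
  · exact h.ne_three hpk
  · exact h.ne_four hpk

/-- Every prime factor of the `n`-th Lehmer number attached to `p = (α + β)²` and `q = αβ` divides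
`(α² - β²)² = p (p - 4 q)` or an earlier Lehmer number. -/
def NoPrimitivePrime (n : ℕ) (p q : ℤ) : Prop :=
  ∀ r : ℕ, r.Prime → (r : ℤ) ∣ lehmerInt p q n →
    (r : ℤ) ∣ p * (p - 4 * q) * ∏ j ∈ Finset.Ico 1 n, lehmerInt p q j

theorem dividesInt_intCast {m : ℕ} {z : ℤ} : DividesInt m (z : ℂ) ↔ (m : ℤ) ∣ z := by
  constructor
  · rintro ⟨t, ht⟩
    exact ⟨t, by exact_mod_cast ht⟩
  · rintro ⟨t, rfl⟩
    exact ⟨t, by push_cast; rfl⟩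

theorem sub_ne_zero_and_add_ne_zero {α β : ℂ} {p q : ℤ} (h : Nondegenerate p q)
    (hp : (α + β) ^ 2 = (p : ℂ)) (hq : α * β = (q : ℂ)) : α - β ≠ 0 ∧ α + β ≠ 0 := by
  constructor
  · intro h0
    apply h.ne_four
    have : (p : ℂ) = 4 * q := by rw [← hp, ← hq]; linear_combination (α - β) * h0
    exact_mod_cast this
  · intro h0
    apply h.p_ne
    have : (p : ℂ) = 0 := by rw [← hp, h0]; ring
    exact_mod_cast this

theorem lehmerNumber_eq {α β : ℂ} {p q : ℤ} (h : Nondegenerate p q)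
    (hp : (α + β) ^ 2 = (p : ℂ)) (hq : α * β = (q : ℂ)) (n : ℕ) :
    lehmerNumber α β n = (lehmerInt p q n : ℂ) := by
  obtain ⟨h1, h2⟩ := sub_ne_zero_and_add_ne_zero h hp hq
  have hb := lehmerInt_binet hp hq n
  unfold lehmerNumber
  split_ifs with hn
  · rw [if_neg (by simpa using hn), mul_one] at hb
    rw [← hb, mul_div_cancel_left₀ _ h1]
  · rw [if_pos (by simpa using hn)] at hb
    have e : α ^ 2 - β ^ 2 = (α - β) * (α + β) := by ring
    rw [← hb, e, mul_div_cancel_left₀ _ (mul_ne_zero h1 h2)]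

theorem isDefectiveLehmerPair_iff {α β : ℂ} {p q : ℤ} (hp : (α + β) ^ 2 = (p : ℂ))
    (hq : α * β = (q : ℂ)) (n : ℕ) :
    IsDefectiveLehmerPair n α β ↔ Nondegenerate p q ∧ NoPrimitivePrime n p q := by
  have key : Nondegenerate p q →
      ((∀ r : ℕ, ¬ IsPrimitiveDivisor α β n r) ↔ NoPrimitivePrime n p q) := by
    intro h
    have e : (α ^ 2 - β ^ 2) ^ 2 * ∏ j ∈ Finset.Ico 1 n, lehmerNumber α β j =
        ((p * (p - 4 * q) * ∏ j ∈ Finset.Ico 1 n, lehmerInt p q j : ℤ) : ℂ) := by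
      simp only [lehmerNumber_eq h hp hq]
      push_cast
      rw [← hp, ← hq]
      ring
    refine forall_congr' fun r => ?_
    rw [IsPrimitiveDivisor, e, lehmerNumber_eq h hp hq, dividesInt_intCast, dividesInt_intCast]
    tauto
  constructor
  · rintro ⟨h, hd⟩
    have h' := h.nondegenerate hp hq
    exact ⟨h', (key h').mp hd⟩
  · rintro ⟨h, hd⟩
    exact ⟨h.isLehmerPair hp hq, (key h).mpr hd⟩

/-- If `r ∣ u_n` but `r` divides neither `p (p - 4 q)` nor `u_{n/ℓ}` for the primes `ℓ ∣ n`,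
then in an algebraic closure of `ℤ/r` the ratio `α / β` has order exactly `n`, so that `r` divides
no earlier Lehmer number. -/
theorem not_dvd_lehmerInt {n r : ℕ} {p q : ℤ} (hn : 2 ≤ n) (hr : r.Prime)
    (hU : (r : ℤ) ∣ lehmerInt p q n) (hp : ¬ (r : ℤ) ∣ p) (hpq : ¬ (r : ℤ) ∣ p - 4 * q)
    (hl : ∀ l : ℕ, l.Prime → l ∣ n → ¬ (r : ℤ) ∣ lehmerInt p q (n / l)) :
    ∀ j ∈ Finset.Ico 1 n, ¬ (r : ℤ) ∣ lehmerInt p q j := by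
  have := Fact.mk hr
  let K := AlgebraicClosure (ZMod r)
  have hdvd : ∀ z : ℤ, (r : ℤ) ∣ z ↔ (z : K) = 0 := fun z =>
    (CharP.intCast_eq_zero_iff K r z).symm
  simp only [hdvd] at *
  obtain ⟨s, hs⟩ := IsAlgClosed.exists_pow_nat_eq (p : K) (n := 2) (by norm_num)
  obtain ⟨x, hx⟩ : ∃ x : K, x * x - s * x + q = 0 := by
    obtain ⟨x, hx⟩ := IsAlgClosed.exists_root
      (Polynomial.X ^ 2 - Polynomial.C s * Polynomial.X + Polynomial.C (q : K)) (by
        have : (Polynomial.X ^ 2 - Polynomial.C s * Polynomial.X + Polynomial.C (q : K)).natDegree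
            = 2 := by compute_degree!
        intro h
        rw [Polynomial.degree_eq_natDegree (by rintro h0; simp [h0] at this), this] at h
        norm_num at h)
    refine ⟨x, ?_⟩
    simpa [Polynomial.IsRoot, sq] using hx
  obtain ⟨y, rfl⟩ : ∃ y, s = x + y := ⟨s - x, by ring⟩
  have hq : x * y = (q : K) := by linear_combination -hx
  have hxy : x - y ≠ 0 := by
    intro h
    apply hpq
    push_cast
    rw [← hs, ← hq]
    linear_combination (x - y) * h
  have hxy' : x + y ≠ 0 := by
    intro h
    apply hp
    rw [← hs, h]
    ring
  have hzero : ∀ j, (lehmerInt p q j : K) = 0 ↔ x ^ j = y ^ j := by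
    intro j
    rw [← sub_eq_zero (a := x ^ j), ← lehmerInt_binet hs hq j]
    have : (x - y) * (if Even j then x + y else 1) ≠ 0 := by
      split_ifs <;> simp [hxy, hxy']
    rw [mul_eq_zero, or_iff_right this]
  have hy : y ≠ 0 := by
    rintro rfl
    have h1 := (hzero n).mp hU
    rw [zero_pow (by omega)] at h1
    exact hxy' (by simpa using pow_eq_zero_iff (by omega) |>.mp h1)
  have hzero' : ∀ j, (lehmerInt p q j : K) = 0 ↔ (x / y) ^ j = 1 := by
    intro j
    rw [hzero, div_pow, div_eq_one_iff_eq (pow_ne_zero _ hy)]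
  simp only [hzero'] at *
  have hord : orderOf (x / y) = n := orderOf_eq_of_pow_and_pow_div_prime (by omega) hU hl
  intro j hj h1
  rw [Finset.mem_Ico] at hj
  have := orderOf_le_of_pow_eq_one (by omega) h1
  omega

/-! ### Primitive divisors and cyclotomic values -/

/-- The absence of primitive prime divisors, in terms of the value `F` of the homogenized `n`-th
cyclotomic polynomial at `(α, β)`: no prime factor of `F` is coprime to `n`. -/
theorem noPrimitivePrime_iff {n : ℕ} {p q : ℤ} (hn : 2 ≤ n) (F G : ℤ)
    (hU : lehmerInt p q n = F * G)
    (hF : ∀ r : ℕ, r.Prime → (r : ℤ) ∣ F → ¬ (r : ℤ) ∣ n → ¬ (r : ℤ) ∣ p ∧ ¬ (r : ℤ) ∣ p - 4 * q ∧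
      ∀ l : ℕ, l.Prime → l ∣ n → ¬ (r : ℤ) ∣ lehmerInt p q (n / l))
    (hG : G ∣ ∏ j ∈ Finset.Ico 1 n, lehmerInt p q j)
    (hFn : ∀ r : ℕ, r.Prime → (r : ℤ) ∣ F → r ∣ n → (r : ℤ) ∣ p ∨ (r : ℤ) ∣ p - 4 * q ∨
      ∃ j ∈ Finset.Ico 1 n, (r : ℤ) ∣ lehmerInt p q j) :
    NoPrimitivePrime n p q ↔ ∀ r : ℕ, r.Prime → (r : ℤ) ∣ F → r ∣ n := by
  constructor
  · intro h r hr hrF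
    by_contra hrn
    obtain ⟨h1, h2, h3⟩ := hF r hr hrF (by exact_mod_cast hrn)
    have hrU : (r : ℤ) ∣ lehmerInt p q n := hU ▸ hrF.mul_right G
    have hr' := Nat.prime_iff_prime_int.mp hr
    rcases hr'.dvd_or_dvd (h r hr hrU) with h4 | h4
    · rcases hr'.dvd_or_dvd h4 with h5 | h5
      exacts [h1 h5, h2 h5]
    · obtain ⟨j, hj, hj'⟩ := hr'.exists_mem_finset_dvd h4
      exact not_dvd_lehmerInt hn hr hrU h1 h2 h3 j hj hj'
  · intro h r hr hrU
    rw [hU] at hrU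
    rcases (Nat.prime_iff_prime_int.mp hr).dvd_or_dvd hrU with h1 | h1
    · rcases hFn r hr h1 (h r hr h1) with h2 | h2 | ⟨j, hj, h2⟩
      · exact (h2.mul_right _).mul_right _
      · exact (h2.mul_left _).mul_right _
      · exact (h2.trans (Finset.dvd_prod_of_mem _ hj)).mul_left _
    · exact (h1.trans hG).mul_left _

/-- A resultant identity `A F + B X = c q ^ N` forbids common prime factors of `F` and `X` away
from `q` and `c ∣ n`. -/
theorem not_dvd_of_resultant {r : ℕ} (hr : r.Prime) {n c q F X : ℤ} (A B : ℤ) (N : ℕ)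
    (hrq : ¬ (r : ℤ) ∣ q) (hrn : ¬ (r : ℤ) ∣ n) (hrF : (r : ℤ) ∣ F) (hc : c ∣ n)
    (h : A * F + B * X = c * q ^ N) : ¬ (r : ℤ) ∣ X := by
  intro hX
  have hr' := Nat.prime_iff_prime_int.mp hr
  have : (r : ℤ) ∣ c * q ^ N := h ▸ (hrF.mul_left A).add (hX.mul_left B)
  rcases hr'.dvd_or_dvd this with h1 | h1
  · exact hrn (h1.trans hc)
  · exact hrq (hr'.dvd_of_dvd_pow h1)

theorem false_of_dvd_of_dvd {r : ℕ} (hr : r.Prime) {p q : ℤ} (hc : IsCoprime p q)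
    (hp : (r : ℤ) ∣ p) (hq : (r : ℤ) ∣ q) : False :=
  (Nat.prime_iff_prime_int.mp hr).not_isUnit (hc.isUnit_of_dvd' hp hq)

/-- `F` is a form in `p`, `q` that is monic in `p`. -/
theorem not_dvd_q {r : ℕ} (hr : r.Prime) {p q F : ℤ} (hc : IsCoprime p q) (hF : (r : ℤ) ∣ F)
    (A : ℤ) (N : ℕ) (h : F = p ^ N + A * q) : ¬ (r : ℤ) ∣ q := by
  intro hq
  have : (r : ℤ) ∣ p ^ N := by
    have := hF.sub (hq.mul_left A)
    rwa [h, add_sub_cancel_right] at this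
  exact false_of_dvd_of_dvd hr hc ((Nat.prime_iff_prime_int.mp hr).dvd_of_dvd_pow this) hq

theorem not_dvd_one {r : ℕ} (hr : r.Prime) : ¬ (r : ℤ) ∣ 1 := by
  exact_mod_cast hr.one_lt.ne' ∘ Nat.dvd_one.mp

theorem dvd_of_sq_dvd {r : ℕ} (hr : r.Prime) {F q s t : ℤ} (hF : (r : ℤ) ^ 2 ∣ F)
    (e : r * q ^ 2 = s * F + r ^ 2 * t) : (r : ℤ) ∣ q := by
  have h : (r : ℤ) * r ∣ r * q ^ 2 := by
    rw [e, ← sq]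
    exact (hF.mul_left s).add (dvd_mul_right _ t)
  exact (Nat.prime_iff_prime_int.mp hr).dvd_of_dvd_pow
    ((mul_dvd_mul_iff_left (by exact_mod_cast hr.ne_zero)).mp h)

theorem lehmerInt_values (p q : ℤ) : lehmerInt p q 1 = 1 ∧ lehmerInt p q 2 = 1 ∧
    lehmerInt p q 3 = p - q ∧ lehmerInt p q 4 = p - 2 * q ∧
    lehmerInt p q 5 = p ^ 2 - 3 * p * q + q ^ 2 ∧ lehmerInt p q 6 = (p - q) * (p - 3 * q) ∧
    lehmerInt p q 8 = (p ^ 2 - 4 * p * q + 2 * q ^ 2) * (p - 2 * q) ∧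
    lehmerInt p q 10 = (p ^ 2 - 5 * p * q + 5 * q ^ 2) * (p ^ 2 - 3 * p * q + q ^ 2) ∧
    lehmerInt p q 12 =
      (p ^ 2 - 4 * p * q + q ^ 2) * ((p - 2 * q) * ((p - q) * (p - 3 * q))) := by
  simp only [lehmerInt, Nat.even_add_one, Even.zero, if_true, if_false,
    not_true_eq_false, not_false_eq_true]
  refine ⟨trivial, ?_, ?_, ?_, ?_, ?_, ?_, ?_, ?_⟩ <;> ring

/-- An integer whose prime factors all divide `m`, each to the first power only. -/
theorem dvd_of_prime_dvd {F m : ℤ} (h : ∀ r : ℕ, r.Prime → (r : ℤ) ∣ F → (r : ℤ) ∣ m)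
    (hsq : ∀ r : ℕ, r.Prime → (r : ℤ) ∣ m → ¬ (r : ℤ) ^ 2 ∣ F) : F ∣ m := by
  have hs : Squarefree F.natAbs := by
    rw [Nat.squarefree_iff_prime_squarefree]
    intro r hr hd
    have hd' : (r : ℤ) ^ 2 ∣ F := by
      rw [sq]
      exact_mod_cast Int.natCast_dvd.mpr hd
    exact hsq r hr (h r hr ((dvd_pow_self _ two_ne_zero).trans hd')) hd'
  rw [← Int.natAbs_dvd_natAbs, ← Nat.prod_primeFactors_of_squarefree hs]
  refine Finset.prod_primes_dvd _ (fun r hr => (Nat.prime_of_mem_primeFactors hr).prime) ?_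
  intro r hr
  have := h r (Nat.prime_of_mem_primeFactors hr)
    (Int.natCast_dvd.mpr (Nat.dvd_of_mem_primeFactors hr))
  exact Int.natCast_dvd.mp this

theorem prime_dvd_of_dvd {F m : ℤ} {n : ℕ} (h : F ∣ m) (hm : ∀ r : ℕ, r.Prime → (r : ℤ) ∣ m → r ∣ n)
    (r : ℕ) (hr : r.Prime) (hrF : (r : ℤ) ∣ F) : r ∣ n :=
  hm r hr (hrF.trans h)

theorem natAbs_eq_prime_pow {F : ℤ} (hF : F ≠ 0) {l : ℕ}
    (h : ∀ r : ℕ, r.Prime → (r : ℤ) ∣ F → r = l) : ∃ k : ℕ, F.natAbs = l ^ k :=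
  ⟨_, Nat.eq_prime_pow_of_unique_prime_dvd (Int.natAbs_ne_zero.mpr hF)
    fun {r} hr hrF => h r hr (Int.natCast_dvd.mpr hrF)⟩

theorem exists_eq_two_pow_mul_three_pow {m : ℕ} (hm : m ≠ 0)
    (h : ∀ r : ℕ, r.Prime → r ∣ m → r = 2 ∨ r = 3) : ∃ k l : ℕ, m = 2 ^ k * 3 ^ l := by
  obtain ⟨k, m', h2, rfl⟩ := Nat.exists_eq_pow_mul_and_not_dvd hm 2 (by norm_num)
  refine ⟨k, _, congrArg _ (Nat.eq_prime_pow_of_unique_prime_dvd (p := 3) ?_ ?_)⟩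
  · rintro rfl
    simp at hm
  · intro r hr hrm
    rcases h r hr (hrm.mul_left _) with rfl | rfl
    exacts [absurd hrm h2, rfl]

/-! ### The defectivity criterion for each `n` -/

theorem noPrimitivePrime_three {p q : ℤ} (hc : IsCoprime p q) :
    NoPrimitivePrime 3 p q ↔ ∀ r : ℕ, r.Prime → (r : ℤ) ∣ p - q → r ∣ 3 := by
  obtain ⟨u1, u2, u3, -⟩ := lehmerInt_values p q
  refine noPrimitivePrime_iff (by norm_num) (p - q) 1 (by rw [u3, mul_one]) ?_ (one_dvd _) ?_
  · intro r hr hF hn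
    have hq := not_dvd_q hr hc hF (-1) 1 (by ring)
    refine ⟨not_dvd_of_resultant hr (c := 1) (-1) 1 1 hq hn hF (by norm_num) (by ring),
      not_dvd_of_resultant hr (c := 3) 1 (-1) 1 hq hn hF (by norm_num) (by ring), ?_⟩
    intro l hl hln
    obtain rfl := (Nat.prime_dvd_prime_iff_eq hl Nat.prime_three).mp hln
    simpa [u1] using not_dvd_one hr
  · intro r hr hF hn
    obtain rfl := (Nat.prime_dvd_prime_iff_eq hr Nat.prime_three).mp hn
    right; left
    push_cast at hF ⊢
    omega

theorem noPrimitivePrime_four {p q : ℤ} (hc : IsCoprime p q) :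
    NoPrimitivePrime 4 p q ↔ ∀ r : ℕ, r.Prime → (r : ℤ) ∣ p - 2 * q → r ∣ 4 := by
  obtain ⟨u1, u2, u3, u4, -⟩ := lehmerInt_values p q
  have two : ∀ l : ℕ, l.Prime → l ∣ 4 → l = 2 := fun l hl h =>
    (Nat.prime_dvd_prime_iff_eq hl Nat.prime_two).mp (hl.dvd_of_dvd_pow (n := 2) h)
  refine noPrimitivePrime_iff (by norm_num) (p - 2 * q) 1 (by rw [u4, mul_one]) ?_ (one_dvd _) ?_
  · intro r hr hF hn
    have hq := not_dvd_q hr hc hF (-2) 1 (by ring)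
    refine ⟨not_dvd_of_resultant hr (c := 2) (-1) 1 1 hq hn hF (by norm_num) (by ring),
      not_dvd_of_resultant hr (c := 2) 1 (-1) 1 hq hn hF (by norm_num) (by ring), ?_⟩
    intro l hl hln
    obtain rfl := two l hl hln
    simpa [u2] using not_dvd_one hr
  · intro r hr hF hn
    obtain rfl := two r hr hn
    left
    push_cast at hF ⊢
    omega

theorem noPrimitivePrime_six {p q : ℤ} (hc : IsCoprime p q) :
    NoPrimitivePrime 6 p q ↔ ∀ r : ℕ, r.Prime → (r : ℤ) ∣ p - 3 * q → r ∣ 6 := by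
  obtain ⟨u1, u2, u3, u4, u5, u6, -⟩ := lehmerInt_values p q
  have two_or_three : ∀ l : ℕ, l.Prime → l ∣ 6 → l = 2 ∨ l = 3 := fun l hl h =>
    (hl.dvd_mul.mp (show l ∣ 2 * 3 from h)).imp
      (Nat.prime_dvd_prime_iff_eq hl Nat.prime_two).mp
      (Nat.prime_dvd_prime_iff_eq hl Nat.prime_three).mp
  refine noPrimitivePrime_iff (by norm_num) (p - 3 * q) (p - q) (by rw [u6, mul_comm]) ?_
    (u3 ▸ Finset.dvd_prod_of_mem _ (by simp)) ?_
  · intro r hr hF hn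
    have hq := not_dvd_q hr hc hF (-3) 1 (by ring)
    refine ⟨not_dvd_of_resultant hr (c := 3) (-1) 1 1 hq hn hF (by norm_num) (by ring),
      not_dvd_of_resultant hr (c := 1) 1 (-1) 1 hq hn hF (by norm_num) (by ring), ?_⟩
    intro l hl hln
    rcases two_or_three l hl hln with rfl | rfl
    · simpa [u3] using not_dvd_of_resultant hr (c := 2) (X := p - q) (-1) 1 1 hq hn hF
        (by norm_num) (by ring)
    · simpa [u2] using not_dvd_one hr
  · intro r hr hF hn
    rcases two_or_three r hr hn with rfl | rfl
    · refine Or.inr (Or.inr ⟨3, by simp, ?_⟩)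
      rw [u3]
      push_cast at hF ⊢
      omega
    · left
      push_cast at hF ⊢
      omega

theorem noPrimitivePrime_five {p q : ℤ} (hc : IsCoprime p q) :
    NoPrimitivePrime 5 p q ↔ p ^ 2 - 3 * p * q + q ^ 2 ∣ 5 := by
  obtain ⟨u1, u2, u3, u4, u5, -⟩ := lehmerInt_values p q
  have five : ∀ l : ℕ, l.Prime → l ∣ 5 → l = 5 := fun l hl h =>
    (Nat.prime_dvd_prime_iff_eq hl Nat.prime_five).mp h
  have h5 : (5 : ℤ) ∣ p ^ 2 - 3 * p * q + q ^ 2 → (5 : ℤ) ∣ p - 4 * q := by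
    intro hF
    refine (Nat.prime_iff_prime_int.mp Nat.prime_five).dvd_of_dvd_pow (n := 2) ?_
    have e : (p - 4 * q) ^ 2 = p ^ 2 - 3 * p * q + q ^ 2 + 5 * (3 * q ^ 2 - p * q) := by ring
    exact e ▸ hF.add (dvd_mul_right _ _)
  rw [noPrimitivePrime_iff (by norm_num) (p ^ 2 - 3 * p * q + q ^ 2) 1 (by rw [u5, mul_one]) ?_
    (one_dvd _) ?_]
  · constructor
    · intro h
      refine dvd_of_prime_dvd (fun r hr hrF => by exact_mod_cast h r hr hrF) ?_
      intro r hr hr5 hF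
      obtain rfl := five r hr (by exact_mod_cast hr5)
      obtain ⟨m, hm⟩ := h5 ((dvd_pow_self _ two_ne_zero).trans hF)
      obtain rfl : p = 4 * q + 5 * m := by linarith
      refine not_dvd_q hr hc ((dvd_pow_self _ two_ne_zero).trans hF) (q - 3 * (4 * q + 5 * m)) 2
        (by ring) (dvd_of_sq_dvd hr hF (s := 1) (t := (- m ^ 2 - m * q)) (by push_cast; ring))
    · intro h
      exact prime_dvd_of_dvd h fun r _ => by exact_mod_cast id
  · intro r hr hF hn
    have hq := not_dvd_q hr hc hF (q - 3 * p) 2 (by ring)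
    refine ⟨not_dvd_of_resultant hr (c := 1) 1 (3 * q - p) 2 hq hn hF (by norm_num) (by ring),
      not_dvd_of_resultant hr (c := 5) 1 (-(p + q)) 2 hq hn hF (by norm_num) (by ring), ?_⟩
    intro l hl hln
    obtain rfl := five l hl hln
    simpa [u1] using not_dvd_one hr
  · intro r hr hF hn
    obtain rfl := five r hr hn
    exact Or.inr (Or.inl (h5 hF))

theorem noPrimitivePrime_eight {p q : ℤ} (hc : IsCoprime p q) :
    NoPrimitivePrime 8 p q ↔ p ^ 2 - 4 * p * q + 2 * q ^ 2 ∣ 2 := by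
  obtain ⟨u1, u2, u3, u4, u5, u6, u8, -⟩ := lehmerInt_values p q
  have two : ∀ l : ℕ, l.Prime → l ∣ 8 → l = 2 := fun l hl h =>
    (Nat.prime_dvd_prime_iff_eq hl Nat.prime_two).mp (hl.dvd_of_dvd_pow (n := 3) h)
  have h2 : (2 : ℤ) ∣ p ^ 2 - 4 * p * q + 2 * q ^ 2 → (2 : ℤ) ∣ p := by
    intro hF
    refine Int.prime_two.dvd_of_dvd_pow (n := 2) ?_
    have e : p ^ 2 = p ^ 2 - 4 * p * q + 2 * q ^ 2 + 2 * (2 * p * q - q ^ 2) := by ring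
    exact e ▸ hF.add (dvd_mul_right _ _)
  rw [noPrimitivePrime_iff (by norm_num) (p ^ 2 - 4 * p * q + 2 * q ^ 2) (p - 2 * q) u8 ?_
    (u4 ▸ Finset.dvd_prod_of_mem _ (by simp)) ?_]
  · constructor
    · intro h
      refine dvd_of_prime_dvd (fun r hr hrF => by rw [two r hr (h r hr hrF)]; rfl) ?_
      intro r hr hr2 hF
      obtain rfl := two r hr ((Int.natCast_dvd_natCast.mp hr2).trans (by norm_num))
      obtain ⟨m, rfl⟩ := h2 ((dvd_pow_self _ two_ne_zero).trans hF)
      refine not_dvd_q hr hc ((dvd_pow_self _ two_ne_zero).trans hF) (2 * q - 4 * (2 * m)) 2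
        (by ring) (dvd_of_sq_dvd hr hF (s := 1) (t := (- m ^ 2 + 2 * m * q)) (by push_cast; ring))
    · intro h
      exact prime_dvd_of_dvd h fun r _ h' => (Int.natCast_dvd_natCast.mp h').trans (by norm_num)
  · intro r hr hF hn
    have hq := not_dvd_q hr hc hF (2 * q - 4 * p) 2 (by ring)
    refine ⟨not_dvd_of_resultant hr (c := 2) 1 (4 * q - p) 2 hq hn hF (by norm_num) (by ring),
      not_dvd_of_resultant hr (c := 2) 1 (-p) 2 hq hn hF (by norm_num) (by ring), ?_⟩
    intro l hl hln
    obtain rfl := two l hl hln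
    simpa [u4] using not_dvd_of_resultant hr (c := 2) (X := p - 2 * q) (-1) (p - 2 * q) 2 hq hn hF
      (by norm_num) (by ring)
  · intro r hr hF hn
    obtain rfl := two r hr hn
    exact Or.inl (h2 hF)

theorem noPrimitivePrime_ten {p q : ℤ} (hc : IsCoprime p q) :
    NoPrimitivePrime 10 p q ↔ p ^ 2 - 5 * p * q + 5 * q ^ 2 ∣ 5 := by
  obtain ⟨u1, u2, u3, u4, u5, u6, u8, u10, -⟩ := lehmerInt_values p q
  have two_or_five : ∀ l : ℕ, l.Prime → l ∣ 10 → l = 2 ∨ l = 5 := fun l hl h =>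
    (hl.dvd_mul.mp (show l ∣ 2 * 5 from h)).imp
      (Nat.prime_dvd_prime_iff_eq hl Nat.prime_two).mp
      (Nat.prime_dvd_prime_iff_eq hl Nat.prime_five).mp
  have h2 : ¬ (2 : ℤ) ∣ p ^ 2 - 5 * p * q + 5 * q ^ 2 := by
    intro hF
    have hpq : ¬ (Even p ∧ Even q) := fun h =>
      false_of_dvd_of_dvd Nat.prime_two hc (by exact_mod_cast h.1.two_dvd)
        (by exact_mod_cast h.2.two_dvd)
    rw [← even_iff_two_dvd] at hF
    have : ¬ Even (5 : ℤ) := by decide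
    simp only [Int.even_add, Int.even_sub, Int.even_mul, Int.even_pow, this] at hF
    tauto
  have h5 : (5 : ℤ) ∣ p ^ 2 - 5 * p * q + 5 * q ^ 2 → (5 : ℤ) ∣ p := by
    intro hF
    refine (Nat.prime_iff_prime_int.mp Nat.prime_five).dvd_of_dvd_pow (n := 2) ?_
    have e : p ^ 2 = p ^ 2 - 5 * p * q + 5 * q ^ 2 + 5 * (p * q - q ^ 2) := by ring
    exact e ▸ hF.add (dvd_mul_right _ _)
  rw [noPrimitivePrime_iff (by norm_num) (p ^ 2 - 5 * p * q + 5 * q ^ 2)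
    (p ^ 2 - 3 * p * q + q ^ 2) u10 ?_ (u5 ▸ Finset.dvd_prod_of_mem _ (by simp)) ?_]
  · constructor
    · intro h
      refine dvd_of_prime_dvd (fun r hr hrF => ?_) ?_
      · rcases two_or_five r hr (h r hr hrF) with rfl | rfl
        exacts [absurd hrF h2, dvd_rfl]
      intro r hr hr5 hF
      obtain rfl := (Nat.prime_dvd_prime_iff_eq hr Nat.prime_five).mp (by exact_mod_cast hr5)
      obtain ⟨m, rfl⟩ := h5 ((dvd_pow_self _ two_ne_zero).trans hF)
      refine not_dvd_q hr hc ((dvd_pow_self _ two_ne_zero).trans hF) (5 * q - 5 * (5 * m)) 2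
        (by ring) (dvd_of_sq_dvd hr hF (s := 1) (t := (- m ^ 2 + m * q)) (by push_cast; ring))
    · intro h
      exact prime_dvd_of_dvd h fun r _ h' => (Int.natCast_dvd_natCast.mp h').trans (by norm_num)
  · intro r hr hF hn
    have hq := not_dvd_q hr hc hF (5 * q - 5 * p) 2 (by ring)
    refine ⟨not_dvd_of_resultant hr (c := 5) 1 (5 * q - p) 2 hq hn hF (by norm_num) (by ring),
      not_dvd_of_resultant hr (c := 1) 1 (q - p) 2 hq hn hF (by norm_num) (by ring), ?_⟩
    intro l hl hln
    rcases two_or_five l hl hln with rfl | rfl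
    · simpa [u5] using not_dvd_of_resultant hr (c := 2) (X := p ^ 2 - 3 * p * q + q ^ 2) (q - p)
        (p - 3 * q) 3 hq hn hF (by norm_num) (by ring)
    · simpa [u2] using not_dvd_one hr
  · intro r hr hF hn
    rcases two_or_five r hr hn with rfl | rfl
    exacts [absurd hF h2, Or.inl (h5 hF)]

theorem noPrimitivePrime_twelve {p q : ℤ} (hc : IsCoprime p q) :
    NoPrimitivePrime 12 p q ↔ p ^ 2 - 4 * p * q + q ^ 2 ∣ 6 := by
  obtain ⟨u1, u2, u3, u4, u5, u6, u8, u10, u12⟩ := lehmerInt_values p q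
  have two_or_three : ∀ l : ℕ, l.Prime → l ∣ 12 → l = 2 ∨ l = 3 := fun l hl h =>
    (hl.dvd_mul.mp (show l ∣ 2 ^ 2 * 3 from h)).imp
      (fun h => (Nat.prime_dvd_prime_iff_eq hl Nat.prime_two).mp (hl.dvd_of_dvd_pow h))
      (Nat.prime_dvd_prime_iff_eq hl Nat.prime_three).mp
  have h2 : (2 : ℤ) ∣ p ^ 2 - 4 * p * q + q ^ 2 → (2 : ℤ) ∣ p - q := by
    intro hF
    refine Int.prime_two.dvd_of_dvd_pow (n := 2) ?_
    have e : (p - q) ^ 2 = p ^ 2 - 4 * p * q + q ^ 2 + 2 * (p * q) := by ring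
    exact e ▸ hF.add (dvd_mul_right _ _)
  have h3 : (3 : ℤ) ∣ p ^ 2 - 4 * p * q + q ^ 2 → (3 : ℤ) ∣ p - 2 * q := by
    intro hF
    refine Int.prime_three.dvd_of_dvd_pow (n := 2) ?_
    have e : (p - 2 * q) ^ 2 = p ^ 2 - 4 * p * q + q ^ 2 + 3 * q ^ 2 := by ring
    exact e ▸ hF.add (dvd_mul_right _ _)
  rw [noPrimitivePrime_iff (by norm_num) (p ^ 2 - 4 * p * q + q ^ 2)
    ((p - 2 * q) * ((p - q) * (p - 3 * q))) u12 ?_ ?_ ?_]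
  · constructor
    · intro h
      refine dvd_of_prime_dvd (fun r hr hrF => ?_) ?_
      · rcases two_or_three r hr (h r hr hrF) with rfl | rfl <;> norm_num
      intro r hr hr6 hF
      have hF' := (dvd_pow_self (r : ℤ) two_ne_zero).trans hF
      have hrq := not_dvd_q hr hc hF' (q - 4 * p) 2 (by ring)
      rcases two_or_three r hr ((Int.natCast_dvd_natCast.mp hr6).trans (by norm_num)) with
        rfl | rfl
      · obtain ⟨m, hm⟩ := h2 hF'
        obtain rfl : p = q + 2 * m := by linarith
        refine hrq (dvd_of_sq_dvd hr hF (s := (-1)) (t := (m ^ 2 - m * q)) (by push_cast; ring))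
      · obtain ⟨m, hm⟩ := h3 hF'
        obtain rfl : p = 2 * q + 3 * m := by linarith
        refine hrq (dvd_of_sq_dvd hr hF (s := (-1)) (t := m ^ 2) (by push_cast; ring))
    · intro h
      exact prime_dvd_of_dvd h fun r _ h' => (Int.natCast_dvd_natCast.mp h').trans (by norm_num)
  · intro r hr hF hn
    have hq := not_dvd_q hr hc hF (q - 4 * p) 2 (by ring)
    refine ⟨not_dvd_of_resultant hr (c := 1) 1 (4 * q - p) 2 hq hn hF (by norm_num) (by ring),
      not_dvd_of_resultant hr (c := 1) 1 (-p) 2 hq hn hF (by norm_num) (by ring), ?_⟩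
    intro l hl hln
    rcases two_or_three l hl hln with rfl | rfl
    · simpa [u6] using not_dvd_of_resultant hr (c := 2) (X := (p - q) * (p - 3 * q)) (-1) 1 2 hq hn
        hF (by norm_num) (by ring)
    · simpa [u4] using not_dvd_of_resultant hr (c := 3) (X := p - 2 * q) (-1) (p - 2 * q) 2 hq hn
        hF (by norm_num) (by ring)
  · rw [← u4, ← u6, ← Finset.prod_pair (f := lehmerInt p q) (by norm_num : 4 ≠ 6)]
    exact Finset.prod_dvd_prod_of_subset _ _ _ (by decide)
  · intro r hr hF hn
    rcases two_or_three r hr hn with rfl | rfl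
    · exact Or.inr (Or.inr ⟨3, by simp, u3 ▸ h2 hF⟩)
    · exact Or.inr (Or.inr ⟨4, by simp, u4 ▸ h3 hF⟩)

/-! ### The recurrence sequences and their norm equations -/

theorem phi_sub_two (k : ℕ) : phi (k - 2) = phi k - phi (k - 1) := by
  have e : phi k = phi (k - 1) + phi (k - 2) := by
    simp only [phi, show ((k : ℤ) + 2).toNat = k + 2 by omega,
      show ((k : ℤ) - 1 + 2).toNat = k + 1 by omega, show ((k : ℤ) - 2 + 2).toNat = k by omega,
      binRec, one_mul]
  linarith

theorem phi_succ (k : ℕ) : phi (k + 1) = phi k + phi (k - 1) := by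
  simp only [phi, show ((k : ℤ) + 1 + 2).toNat = k + 1 + 2 by omega,
    show ((k : ℤ) + 2).toNat = k + 1 + 1 by omega, show ((k : ℤ) - 1 + 2).toNat = k + 1 by omega,
    binRec, one_mul]

theorem phi_add_two (k : ℕ) : phi (k + 2) = 2 * phi k + phi (k - 1) := by
  have h := phi_succ (k + 1)
  push_cast at h
  rw [add_sub_cancel_right, phi_succ, add_assoc (k : ℤ), one_add_one_eq_two] at h
  linarith

theorem psi_sub_two (k : ℕ) : psi (k - 2) = psi k - psi (k - 1) := by
  have e : psi k = psi (k - 1) + psi (k - 2) := by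
    simp only [psi, show ((k : ℤ) + 2).toNat = k + 2 by omega,
      show ((k : ℤ) - 1 + 2).toNat = k + 1 by omega, show ((k : ℤ) - 2 + 2).toNat = k by omega,
      binRec, one_mul]
  linarith

theorem psi_succ (k : ℕ) : psi (k + 1) = psi k + psi (k - 1) := by
  simp only [psi, show ((k : ℤ) + 1 + 2).toNat = k + 1 + 2 by omega,
    show ((k : ℤ) + 2).toNat = k + 1 + 1 by omega, show ((k : ℤ) - 1 + 2).toNat = k + 1 by omega,
    binRec, one_mul]

theorem psi_add_two (k : ℕ) : psi (k + 2) = 2 * psi k + psi (k - 1) := by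
  have h := psi_succ (k + 1)
  push_cast at h
  rw [add_sub_cancel_right, psi_succ, add_assoc (k : ℤ), one_add_one_eq_two] at h
  linarith

theorem phi_nonneg (k : ℕ) : 0 ≤ phi k ∧ 0 ≤ phi (k - 1) ∧ 0 < phi k + phi (k - 1) := by
  induction k with
  | zero => decide
  | succ k ih =>
    push_cast
    rw [add_sub_cancel_right, phi_succ]
    omega

theorem phi_add_two_strictMono : StrictMono fun k : ℕ => phi (k + 2) := by
  refine strictMono_nat_of_lt_succ fun k => ?_
  have h := phi_succ (k + 2)
  have h1 := phi_succ k
  have h0 := phi_nonneg k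
  push_cast at h ⊢
  rw [show (k : ℤ) + 2 - 1 = k + 1 by ring] at h
  rw [show (k : ℤ) + 1 + 2 = k + 2 + 1 by ring, h, h1]
  omega

theorem phi_injOn {k l : ℕ} (hk : 2 ≤ k) (hl : 2 ≤ l) (h : phi k = phi l) : k = l := by
  obtain ⟨k, rfl⟩ := Nat.exists_eq_add_of_le' hk
  obtain ⟨l, rfl⟩ := Nat.exists_eq_add_of_le' hl
  rw [phi_add_two_strictMono.injective (a₁ := k) (a₂ := l) (by simpa using h)]

theorem two_le_phi {k : ℕ} (hk : 3 ≤ k) : 2 ≤ phi k := by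
  obtain ⟨k, rfl⟩ := Nat.exists_eq_add_of_le' hk
  have := phi_add_two_strictMono.monotone (show 1 ≤ k + 1 by omega)
  have h3 : phi 3 = 2 := by decide
  simp only [Nat.cast_one, Nat.cast_add] at this
  push_cast
  rw [show (1 : ℤ) + 2 = 3 by norm_num, h3] at this
  rwa [show (k : ℤ) + 3 = k + 1 + 2 by ring]

theorem psi_pos (k : ℕ) : 0 < psi (k + 1) ∧ 0 < psi k := by
  induction k with
  | zero => decide
  | succ k ih =>
    have h := psi_succ (k + 1)
    push_cast at h ⊢
    rw [add_sub_cancel_right] at h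
    rw [h]
    omega

theorem psi_add_one_strictMono : StrictMono fun k : ℕ => psi (k + 1) := by
  refine strictMono_nat_of_lt_succ fun k => ?_
  have h := psi_succ (k + 1)
  have h0 := psi_pos k
  push_cast at h ⊢
  rw [h, add_sub_cancel_right]
  omega

theorem three_le_psi {k : ℕ} (hk : 2 ≤ k) : 3 ≤ psi k := by
  obtain ⟨k, rfl⟩ := Nat.exists_eq_add_of_le' hk
  have := psi_add_one_strictMono.monotone (show 1 ≤ k + 1 by omega)
  have h3 : psi 2 = 3 := by decide
  simp only [Nat.cast_one, Nat.cast_add] at this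
  push_cast
  rw [show (1 : ℤ) + 1 = 2 by norm_num, h3] at this
  rwa [show (k : ℤ) + 2 = k + 1 + 1 by ring]

theorem psi_injective : Function.Injective fun k : ℕ => psi k := by
  have h0 : psi 0 = 2 := by decide
  have h1 : psi 1 = 1 := by decide
  have key : ∀ l : ℕ, psi ((l + 1 : ℕ) : ℤ) ≠ 2 := by
    intro l h
    rcases l with _ | l
    · simp [h1] at h
    · have := three_le_psi (show 2 ≤ l + 1 + 1 by omega)
      omega
  intro k l h
  rcases k with _ | k <;> rcases l with _ | l
  · rfl
  · exact absurd (by simpa [h0] using h.symm) (key l)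
  · exact absurd (by simpa [h0] using h) (key k)
  · rw [psi_add_one_strictMono.injective (a₁ := k) (a₂ := l) (by simpa using h)]

theorem phi_norm (k : ℕ) : IsCoprime (phi (k - 1)) (phi k) ∧
    |phi k ^ 2 - phi (k - 1) * phi k - phi (k - 1) ^ 2| = 1 := by
  induction k with
  | zero => decide
  | succ k ih =>
    obtain ⟨⟨a, b, h⟩, h'⟩ := ih
    push_cast
    rw [add_sub_cancel_right, phi_succ]
    refine ⟨⟨b - a, a, by linear_combination h⟩, ?_⟩
    refine Eq.trans ?_ h'
    rw [← abs_neg]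
    congr 1
    ring

theorem psi_norm (k : ℕ) : IsCoprime (psi (k - 1)) (psi k) ∧
    |psi k ^ 2 - psi (k - 1) * psi k - psi (k - 1) ^ 2| = 5 := by
  induction k with
  | zero => decide
  | succ k ih =>
    obtain ⟨⟨a, b, h⟩, h'⟩ := ih
    push_cast
    rw [add_sub_cancel_right, psi_succ]
    refine ⟨⟨b - a, a, by linear_combination h⟩, ?_⟩
    refine Eq.trans ?_ h'
    rw [← abs_neg]
    congr 1
    ring

/-- Descent `(u, y) ↦ (y - u, u)` on the norm equation `|y² - u y - u²| = 1`. -/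
theorem exists_phi {u y : ℤ} (hu : 0 ≤ u) (hy : 0 ≤ y) (h : |y ^ 2 - u * y - u ^ 2| = 1) :
    ∃ k : ℕ, u = phi (k - 1) ∧ y = phi k := by
  obtain ⟨n, rfl⟩ := Int.eq_ofNat_of_zero_le hy
  induction n using Nat.strong_induction_on generalizing u with
  | _ n ih =>
    rcases Nat.eq_zero_or_pos n with rfl | hn
    · refine ⟨0, ?_, by decide⟩
      have h1 : u ^ 2 = 1 := by simpa using h
      have : u = 1 := by nlinarith
      rw [this]; decide
    have hn' : (1 : ℤ) ≤ n := by exact_mod_cast hn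
    have h2 := (abs_eq (by norm_num)).mp h
    have hun : u ≤ n := by
      by_contra! hlt
      rcases h2 with h2 | h2 <;> nlinarith
    by_cases hu1 : u = n
    · subst hu1
      have : (n : ℤ) = 1 := by rcases h2 with h2 | h2 <;> nlinarith
      rw [this]
      exact ⟨2, by decide, by decide⟩
    · obtain ⟨m, rfl⟩ := Int.eq_ofNat_of_zero_le hu
      obtain ⟨k, hk1, hk2⟩ := ih m (by omega) (u := n - m) (by omega) (by omega) (by
        rw [← h, ← abs_neg]; congr 1; ring)
      refine ⟨k + 1, ?_, ?_⟩
      · push_cast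
        rw [add_sub_cancel_right]
        exact hk2
      · push_cast
        rw [phi_succ]
        linarith

/-- Descent `(u, y) ↦ (y - u, u)` on the norm equation `|y² - u y - u²| = 5`. -/
theorem exists_psi {u y : ℤ} (hu : 0 ≤ u) (hy : 0 ≤ y) (h : |y ^ 2 - u * y - u ^ 2| = 5) :
    ∃ k : ℕ, u = psi (k - 1) ∧ y = psi k := by
  obtain ⟨n, rfl⟩ := Int.eq_ofNat_of_zero_le hy
  induction n using Nat.strong_induction_on generalizing u with
  | _ n ih =>
    have h2 := (abs_eq (by norm_num)).mp h
    rcases Nat.eq_zero_or_pos n with rfl | hn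
    · exfalso
      have h1 : u ^ 2 = 5 := by simpa using h
      have : u ≤ 2 := by nlinarith
      interval_cases u <;> omega
    have hn' : (1 : ℤ) ≤ n := by exact_mod_cast hn
    by_cases hun : u < n
    · obtain ⟨m, rfl⟩ := Int.eq_ofNat_of_zero_le hu
      obtain ⟨k, hk1, hk2⟩ := ih m (by omega) (u := n - m) (by omega) (by omega) (by
        rw [← h, ← abs_neg]; congr 1; ring)
      refine ⟨k + 1, ?_, ?_⟩
      · push_cast
        rw [add_sub_cancel_right]
        exact hk2
      · push_cast
        rw [psi_succ]
        linarith
    · push Not at hun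
      have hu2 : u ≤ 2 := by
        rcases h2 with h2 | h2 <;> nlinarith
      have hn2 : (n : ℤ) ≤ 2 := by omega
      generalize (n : ℤ) = y at *
      interval_cases u <;> interval_cases y <;> first | omega | exact ⟨1, by decide, by decide⟩

theorem pell_rho_shift (k : ℕ) : pell (k - 1) = rho k - pell k ∧
    rho (k - 1) = 2 * pell k - rho k ∧ pell (k + 1) = rho k + pell k ∧
    rho (k + 1) = rho k + 2 * pell k := by
  have hp : ∀ k : ℕ, pell (k + 1) = 2 * pell k + pell (k - 1) := fun k => by
    simp only [pell, show ((k : ℤ) + 1 + 1).toNat = k + 2 by omega,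
      show ((k : ℤ) + 1).toNat = k + 1 by omega, show ((k : ℤ) - 1 + 1).toNat = k by omega,
      binRec, one_mul]
  have hr : ∀ k : ℕ, rho (k + 1) = 2 * rho k + rho (k - 1) := fun k => by
    simp only [rho, show ((k : ℤ) + 1 + 1).toNat = k + 2 by omega,
      show ((k : ℤ) + 1).toNat = k + 1 by omega, show ((k : ℤ) - 1 + 1).toNat = k by omega,
      binRec, one_mul]
  have key : pell (k - 1) = rho k - pell k ∧ rho (k - 1) = 2 * pell k - rho k := by
    induction k with
    | zero => decide
    | succ k ih =>
      push_cast
      rw [add_sub_cancel_right, hp, hr]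
      omega
  rw [hp, hr]
  omega

theorem pell_norm (k : ℕ) : |rho k ^ 2 - 2 * pell k ^ 2| = 1 ∧ 0 < rho k ∧ 0 ≤ pell k := by
  induction k with
  | zero => decide
  | succ k ih =>
    obtain ⟨-, -, h1, h2⟩ := pell_rho_shift k
    push_cast
    rw [h1, h2]
    refine ⟨?_, by omega, by omega⟩
    rw [← ih.1, ← abs_neg]
    congr 1
    ring

theorem pell_strictMono : StrictMono fun k : ℕ => pell k := by
  refine strictMono_nat_of_lt_succ fun k => ?_
  obtain ⟨-, -, h1, h2⟩ := pell_rho_shift k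
  have := pell_norm k
  push_cast
  omega

theorem rho_injOn {k l : ℕ} (hk : 1 ≤ k) (hl : 1 ≤ l) (h : rho k = rho l) : k = l := by
  have mono : StrictMono fun k : ℕ => rho (k + 1) := by
    refine strictMono_nat_of_lt_succ fun k => ?_
    obtain ⟨-, -, h1, h2⟩ := pell_rho_shift k
    obtain ⟨-, -, h3, h4⟩ := pell_rho_shift (k + 1)
    have := pell_norm k
    push_cast at h4 ⊢
    omega
  obtain ⟨k, rfl⟩ := Nat.exists_eq_add_of_le' hk
  obtain ⟨l, rfl⟩ := Nat.exists_eq_add_of_le' hl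
  rw [mono.injective (a₁ := k) (a₂ := l) (by simpa using h)]

theorem two_le_pell_rho {k : ℕ} (hk : 2 ≤ k) : 2 ≤ pell k ∧ 2 ≤ rho k := by
  have h2 : pell 2 = 2 := by decide
  have h := pell_strictMono.monotone hk
  simp only [Nat.cast_ofNat, h2] at h
  refine ⟨h, ?_⟩
  obtain ⟨h1, -⟩ := pell_norm k
  have h0 := (pell_norm k).2.1
  rcases (abs_eq (by norm_num)).mp h1 with h1 | h1 <;> nlinarith

/-- Descent `(x, y) ↦ (2 y - x, x - y)` on the norm equation `|x² - 2 y²| = 1`. -/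
theorem exists_pell {x y : ℤ} (hx : 0 ≤ x) (hy : 0 ≤ y) (h : |x ^ 2 - 2 * y ^ 2| = 1) :
    ∃ k : ℕ, x = rho k ∧ y = pell k := by
  obtain ⟨n, rfl⟩ := Int.eq_ofNat_of_zero_le hy
  induction n using Nat.strong_induction_on generalizing x with
  | _ n ih =>
    rcases Nat.eq_zero_or_pos n with rfl | hn
    · refine ⟨0, ?_, by decide⟩
      have h1 : x ^ 2 = 1 := by simpa using h
      have : x = 1 := by nlinarith
      rw [this]; decide
    have hn' : (1 : ℤ) ≤ n := by exact_mod_cast hn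
    have h2 := (abs_eq (by norm_num)).mp h
    have h3 : (n : ℤ) ≤ x := by
      by_contra! hlt
      rcases h2 with h2 | h2 <;> nlinarith
    have h4 : x < 2 * n := by
      by_contra! hlt
      rcases h2 with h2 | h2 <;> nlinarith
    obtain ⟨m, hm⟩ := Int.eq_ofNat_of_zero_le (sub_nonneg.mpr h3)
    obtain ⟨k, hk1, hk2⟩ := ih m (by omega) (x := 2 * n - x) (by omega) (by omega) (by
        rw [← hm, ← h, ← abs_neg]; congr 1; ring)
    obtain ⟨-, -, h5, h6⟩ := pell_rho_shift k
    refine ⟨k + 1, ?_, ?_⟩ <;> push_cast <;> omega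

theorem zeta_succ (i : Fin 4) (k : ℕ) : zeta i (k + 1) = 4 * zeta i k - zeta i (k - 1) := by
  simp only [zeta, show ((k : ℤ) + 1 + 1).toNat = k + 2 by omega,
    show ((k : ℤ) + 1).toNat = k + 1 by omega, show ((k : ℤ) - 1 + 1).toNat = k by omega, binRec]
  ring

/-- The value of `p² - 4 p q + q²` on the pairs `(ζ⁽ⁱ⁾_{k-1}, ζ⁽ⁱ⁾_k)`. -/
def zetaNorm (i : Fin 4) : ℤ := (![1, -3, -2, 6] : Fin 4 → ℤ) i

theorem zeta_norm (i : Fin 4) (k : ℕ) : IsCoprime (zeta i (k - 1)) (zeta i k) ∧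
    zeta i (k - 1) ^ 2 - 4 * zeta i (k - 1) * zeta i k + zeta i k ^ 2 = zetaNorm i := by
  induction k with
  | zero => fin_cases i <;> decide
  | succ k ih =>
    obtain ⟨⟨a, b, h⟩, h'⟩ := ih
    push_cast
    rw [add_sub_cancel_right, zeta_succ]
    refine ⟨⟨b + 4 * a, -a, by linear_combination h⟩, ?_⟩
    rw [← h']
    ring

theorem zeta_nonneg (i : Fin 4) (k : ℕ) : 0 ≤ zeta i k ∧ zeta i k < zeta i (k + 1) := by
  induction k with
  | zero => fin_cases i <;> decide
  | succ k ih =>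
    have := zeta_succ i (k + 1)
    push_cast at this ⊢
    rw [add_sub_cancel_right] at this
    rw [this]
    omega

theorem zeta_strictMono (i : Fin 4) : StrictMono fun k : ℕ => zeta i k :=
  strictMono_nat_of_lt_succ fun k => by simpa using (zeta_nonneg i k).2

/-- Descent `(a, q) ↦ (4 a - q, a)` on the norm equation `a² - 4 a q + q² = c`, `c ∣ 6`. -/
theorem exists_zeta {a q : ℤ} (hq : 0 < q) (ha : a ≤ 2 * q) (h : a ^ 2 - 4 * a * q + q ^ 2 ∣ 6) :
    ∃ (i : Fin 4) (k : ℕ), a = zeta i (k - 1) ∧ q = zeta i k := by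
  obtain ⟨n, rfl⟩ := Int.eq_ofNat_of_zero_le hq.le
  induction n using Nat.strong_induction_on generalizing a with
  | _ n ih =>
    have h1 := Int.le_of_dvd (by norm_num) h
    have h2 := Int.le_of_dvd (by norm_num) ((neg_dvd).mpr h)
    rcases le_or_gt a 0 with h0 | h0
    · -- For `a ≤ -2` the norm exceeds `6`.
      have ha1 : -1 ≤ a := by nlinarith
      have hn2 : (n : ℤ) ≤ 2 := by nlinarith
      generalize (n : ℤ) = q at *
      interval_cases a <;> interval_cases q <;> revert h <;> norm_num
      exacts [⟨3, 0, by decide, by decide⟩, ⟨0, 1, by decide, by decide⟩]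
    · rcases le_or_gt (n : ℤ) a with h3 | h3
      · -- For `q ≤ a ≤ 2 q` the norm is at most `-2 q²`.
        have hn1 : (n : ℤ) ≤ 1 := by nlinarith
        generalize (n : ℤ) = q at *
        obtain rfl : q = 1 := by omega
        have : a ≤ 2 := by omega
        interval_cases a
        exacts [⟨2, 0, by decide, by decide⟩, ⟨1, 0, by decide, by decide⟩]
      · obtain ⟨m, rfl⟩ := Int.eq_ofNat_of_zero_le h0.le
        -- For `a < q < 2 a` the norm is less than `-2 a²`, so the descent stays in its domain.
        have h4 : 2 * (m : ℤ) ≤ n := by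
          by_contra! hlt
          have : (2 : ℤ) ≤ m := by omega
          nlinarith [mul_pos (sub_pos.mpr h3) (sub_pos.mpr hlt)]
        obtain ⟨i, k, hk1, hk2⟩ := ih m (by omega) (a := 4 * m - n) h0 (by omega) (by
          convert h using 1; ring)
        refine ⟨i, k + 1, ?_, ?_⟩
        · push_cast
          rwa [add_sub_cancel_right]
        · push_cast
          rw [zeta_succ]
          omega

/-! ### Table entries and equivalence -/

/-- The product `αβ = (a - b) / 4` attached to a table entry. -/
def Entry.q : {n : ℕ} → Entry n → ℤ
  | _, .three₁ q _ => q
  | _, .three₂ _ q _ _ _ => q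
  | _, .four₁ q _ => q
  | _, .four₂ _ q _ _ _ => q
  | _, .five₁ k _ _ _ => phi k
  | _, .five₂ k _ _ _ => psi k
  | _, .six₁ q _ => q
  | _, .six₂ _ q _ _ _ => q
  | _, .six₃ _ q _ _ _ => q
  | _, .six₄ _ _ q _ _ _ => q
  | _, .eight₁ k _ _ _ => pell k
  | _, .eight₂ k _ _ _ => rho k
  | _, .ten₁ k _ _ _ => -phi k
  | _, .ten₂ k _ _ _ => -psi k
  | _, .twelve i k _ _ _ => zeta i k

theorem Entry.ab_snd {n : ℕ} (e : Entry n) : e.ab.2 = e.ab.1 - 4 * e.q := by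
  cases e with
  | twelve i k ε hε h =>
    have := zeta_succ i k
    rcases hε with rfl | rfl <;> simp only [Entry.ab, Entry.q, sub_neg_eq_add, ← sub_eq_add_neg] <;>
      omega
  | _ => simp only [Entry.ab, Entry.q] <;> ring

theorem Nondegenerate.neg {p q : ℤ} (h : Nondegenerate p q) : Nondegenerate (-p) (-q) where
  coprime := h.coprime.neg_neg
  p_ne := neg_ne_zero.mpr h.p_ne
  q_ne := neg_ne_zero.mpr h.q_ne
  ne_one := fun h' => h.ne_one (by omega)
  ne_two := fun h' => h.ne_two (by omega)
  ne_three := fun h' => h.ne_three (by omega)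
  ne_four := fun h' => h.ne_four (by omega)

/-- The pair `(α, -β)` has the invariants `(p - 4 q, -q)`. -/
theorem Nondegenerate.conj {p q : ℤ} (h : Nondegenerate p q) : Nondegenerate (p - 4 * q) (-q) where
  coprime := by
    obtain ⟨a, b, e⟩ := h.coprime
    exact ⟨a, -b - 4 * a, by linear_combination e⟩
  p_ne := fun h' => h.ne_four (by omega)
  q_ne := neg_ne_zero.mpr h.q_ne
  ne_one := fun h' => h.ne_three (by omega)
  ne_two := fun h' => h.ne_two (by omega)
  ne_three := fun h' => h.ne_one (by omega)
  ne_four := fun h' => h.p_ne (by omega)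

/-- If `p = c q` with `p`, `q` coprime, then `q` is a unit. -/
theorem nondegenerate_of_coprime {p q : ℤ} (hc : IsCoprime p q) (h0 : q ≠ 0) (h1 : q ≠ 1)
    (h2 : q ≠ -1) : Nondegenerate p q := by
  have key : ∀ c : ℤ, p ≠ c * q := by
    rintro c rfl
    have := Int.isUnit_iff.mp (hc.isUnit_of_dvd' (dvd_mul_left q c) dvd_rfl)
    tauto
  exact ⟨hc, by simpa using key 0, h0, by simpa using key 1, key 2, key 3, key 4⟩

/-- The pairs of a table entry are those with `(α + β)² = a` and `αβ = (a - b) / 4`. -/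
theorem Entry.isPairOf_iff {n : ℕ} (e : Entry n) {α β : ℂ} :
    IsPairOf e.ab.1 e.ab.2 α β ↔ (α + β) ^ 2 = (e.ab.1 : ℂ) ∧ α * β = (e.q : ℂ) := by
  rw [e.ab_snd]
  constructor
  · rintro ⟨s, t, hs, ht, rfl, rfl⟩
    push_cast at ht
    constructor
    · rw [← hs]; ring
    · linear_combination (hs - ht) / 4
  · rintro ⟨h1, h2⟩
    refine ⟨α + β, β - α, h1, ?_, by ring, by ring⟩
    push_cast
    linear_combination h1 - 4 * h2

/-- Up to equivalence, a Lehmer pair is determined by `(p, q)` up to a common sign. -/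
theorem classification_of_integers {n : ℕ}
    (hex : ∀ p q : ℤ, Nondegenerate p q → NoPrimitivePrime n p q →
      (∃ e : Entry n, e.ab.1 = p ∧ e.q = q) ∨ ∃ e : Entry n, e.ab.1 = -p ∧ e.q = -q)
    (hval : ∀ e : Entry n, Nondegenerate e.ab.1 e.q ∧ NoPrimitivePrime n e.ab.1 e.q)
    (hinj : ∀ e e' : Entry n, e.ab.1 = e'.ab.1 → e.q = e'.q → e = e')
    (hneg : ∀ e e' : Entry n, ¬ (e.ab.1 = -e'.ab.1 ∧ e.q = -e'.q)) :
    (∀ α β : ℂ, IsDefectiveLehmerPair n α β →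
      ∃ (e : Entry n) (γ δ : ℂ), IsPairOf e.ab.1 e.ab.2 γ δ ∧ PairEquiv α β γ δ) ∧
    (∀ (e : Entry n) (α β : ℂ), IsPairOf e.ab.1 e.ab.2 α β → IsDefectiveLehmerPair n α β) ∧
    (∀ e e' : Entry n, e ≠ e' → ∀ α β α' β' : ℂ, IsPairOf e.ab.1 e.ab.2 α β →
      IsPairOf e'.ab.1 e'.ab.2 α' β' → ¬ PairEquiv α β α' β') := by
  refine ⟨fun α β h => ?_, fun e α β h => ?_, fun e e' hne α β α' β' h h' heq => ?_⟩
  · obtain ⟨p, q, -, hq0, -, hp, hq⟩ := h.1.2.2.1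
    have hα : α ≠ 0 := by rintro rfl; simp [eq_comm, hq0] at hq
    have hβ : β ≠ 0 := by rintro rfl; simp [eq_comm, hq0] at hq
    obtain ⟨hn, hd⟩ := (isDefectiveLehmerPair_iff hp hq n).mp h
    rcases hex p q hn hd with ⟨e, he1, he2⟩ | ⟨e, he1, he2⟩
    · refine ⟨e, α, β, e.isPairOf_iff.mpr ⟨by rw [hp, he1], by rw [hq, he2]⟩, ?_, ?_⟩
      · rw [div_self hα, div_self hβ]
      · simp [div_self hα]
    · have hI : ∀ z : ℂ, z ≠ 0 → z / (Complex.I * z) = -Complex.I := fun z hz => by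
        rw [div_mul_cancel_right₀ hz, Complex.inv_I]
      refine ⟨e, Complex.I * α, Complex.I * β, e.isPairOf_iff.mpr ⟨?_, ?_⟩, ?_, ?_⟩
      · rw [he1, Int.cast_neg, ← hp]
        linear_combination (α + β) ^ 2 * Complex.I_sq
      · rw [he2, Int.cast_neg, ← hq]
        linear_combination α * β * Complex.I_sq
      · rw [hI α hα, hI β hβ]
      · rw [hI α hα]
        simp
  · obtain ⟨h1, h2⟩ := e.isPairOf_iff.mp h
    exact (isDefectiveLehmerPair_iff h1 h2 n).mpr (hval e)
  · obtain ⟨h1, h2⟩ := e.isPairOf_iff.mp h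
    obtain ⟨h1', h2'⟩ := e'.isPairOf_iff.mp h'
    have hq0 : (e'.q : ℂ) ≠ 0 := by exact_mod_cast (hval e').1.q_ne
    have hα : α' ≠ 0 := by rintro rfl; exact hq0 (by simpa using h2'.symm)
    have hβ : β' ≠ 0 := by rintro rfl; exact hq0 (by simpa using h2'.symm)
    obtain ⟨hc, hmem⟩ := heq
    generalize hcdef : α / α' = c at hc hmem
    obtain rfl : α = c * α' := (div_eq_iff hα).mp hcdef
    obtain rfl : β = c * β' := (div_eq_iff hβ).mp hc.symm
    have e1 : (e.ab.1 : ℂ) = c ^ 2 * e'.ab.1 := by rw [← h1, ← h1']; ring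
    have e2 : (e.q : ℂ) = c ^ 2 * e'.q := by rw [← h2, ← h2']; ring
    have hc2 : c ^ 2 = 1 ∨ c ^ 2 = -1 := by
      rcases hmem with rfl | rfl | rfl | rfl <;> simp
    rcases hc2 with hc2 | hc2 <;> rw [hc2] at e1 e2
    · refine hne (hinj e e' ?_ ?_)
      · exact_mod_cast (one_mul (e'.ab.1 : ℂ)) ▸ e1
      · exact_mod_cast (one_mul (e'.q : ℂ)) ▸ e2
    · refine hneg e e' ⟨?_, ?_⟩
      · have : (e.ab.1 : ℂ) = ((-e'.ab.1 : ℤ) : ℂ) := by rw [e1]; push_cast; ring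
        exact_mod_cast this
      · have : (e.q : ℂ) = ((-e'.q : ℤ) : ℂ) := by rw [e2]; push_cast; ring
        exact_mod_cast this

/-! ### The linear cases `n = 3, 4, 6` -/

theorem eq_or_eq_neg_of_natAbs {F : ℤ} {m : ℕ} (h : F.natAbs = m) : F = m ∨ -F = m := by omega

theorem Entry.three_sub (e : Entry 3) : ∃ k : ℕ, e.ab.1 - e.q = 3 ^ k := by
  cases e with
  | three₁ q h => exact ⟨0, by simp [Entry.ab, Entry.q]⟩
  | three₂ k q hk hq h => exact ⟨k, by simp [Entry.ab, Entry.q]⟩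

theorem exists_entry_three {p q : ℤ} (h : Nondegenerate p q) {k : ℕ} (hk : p - q = 3 ^ k) :
    ∃ e : Entry 3, e.ab.1 = p ∧ e.q = q := by
  obtain ⟨hc, hp0, hq0, h1, h2, h3, h4⟩ := h
  obtain rfl : p = 3 ^ k + q := by omega
  rcases Nat.eq_zero_or_pos k with rfl | hk0
  · exact ⟨.three₁ q (by omega), by simp [Entry.ab], rfl⟩
  · have hq : ¬ (3 : ℤ) ∣ q := fun hq =>
      false_of_dvd_of_dvd Nat.prime_three hc ((dvd_pow_self _ hk0.ne').add hq) hq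
    have hkq : (k, q) ≠ (1, 1) := by
      rintro ⟨⟩
      norm_num at h4
    exact ⟨.three₂ k q hk0 hq hkq, rfl, rfl⟩

theorem isCoprime_prime_pow_add {r : ℤ} (hr : Prime r) {q : ℤ} (hq : ¬ r ∣ q) (k : ℕ) (c : ℤ) :
    IsCoprime (r ^ k + c * q) q :=
  (IsCoprime.add_mul_right_left_iff (z := c)).mpr
    (((Prime.coprime_iff_not_dvd hr).mpr hq).pow_left)

theorem nondegenerate_entry_three (e : Entry 3) : Nondegenerate e.ab.1 e.q := by
  cases e with
  | three₁ q h =>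
    refine nondegenerate_of_coprime ?_ h.2.1 h.2.2 h.1
    exact ⟨1, -1, by simp only [Entry.ab, Entry.q]; ring⟩
  | three₂ k q hk hq h =>
    have hc : IsCoprime ((3 : ℤ) ^ k + q) q := by
      simpa using isCoprime_prime_pow_add Int.prime_three hq k 1
    simp only [Entry.ab, Entry.q]
    have h3 : (3 : ℤ) ^ 1 ≤ 3 ^ k := pow_le_pow_right₀ (by norm_num) hk
    by_cases h1 : q = 1
    · subst h1
      have hk1 : 2 ≤ k := by
        by_contra! hlt
        exact h (by rw [show k = 1 by omega])
      have h9 : (3 : ℤ) ^ 2 ≤ 3 ^ k := pow_le_pow_right₀ (by norm_num) hk1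
      exact ⟨hc, by omega, by omega, by omega, by omega, by omega, by omega⟩
    by_cases h2 : q = -1
    · subst h2
      exact ⟨hc, by omega, by omega, by omega, by omega, by omega, by omega⟩
    · exact nondegenerate_of_coprime hc (by rintro rfl; simp at hq) h1 h2

theorem prime_eq_of_dvd_pow {r l k : ℕ} (hr : r.Prime) (hl : l.Prime) {F : ℤ}
    (hF : F = (l : ℤ) ^ k) (h : (r : ℤ) ∣ F) : r = l := by
  rw [hF] at h
  have h' : r ∣ l ^ k := by exact_mod_cast h
  exact (Nat.prime_dvd_prime_iff_eq hr hl).mp (hr.dvd_of_dvd_pow h')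

theorem classification_three :
    (∀ p q : ℤ, Nondegenerate p q → NoPrimitivePrime 3 p q →
      (∃ e : Entry 3, e.ab.1 = p ∧ e.q = q) ∨ ∃ e : Entry 3, e.ab.1 = -p ∧ e.q = -q) ∧
    (∀ e : Entry 3, Nondegenerate e.ab.1 e.q ∧ NoPrimitivePrime 3 e.ab.1 e.q) ∧
    (∀ e e' : Entry 3, e.ab.1 = e'.ab.1 → e.q = e'.q → e = e') ∧
    (∀ e e' : Entry 3, ¬ (e.ab.1 = -e'.ab.1 ∧ e.q = -e'.q)) := by
  refine ⟨fun p q hn hd => ?_, fun e => ?_, fun e e' h1 h2 => ?_, fun e e' h => ?_⟩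
  · rw [noPrimitivePrime_three hn.coprime] at hd
    obtain ⟨k, hk⟩ := natAbs_eq_prime_pow (sub_ne_zero.mpr hn.ne_one) (l := 3) fun r hr hrF =>
      (Nat.prime_dvd_prime_iff_eq hr Nat.prime_three).mp (hd r hr hrF)
    refine (eq_or_eq_neg_of_natAbs hk).imp (fun h => ?_) (fun h => ?_)
    · exact exists_entry_three hn (k := k) (by simpa using h)
    · exact exists_entry_three hn.neg (k := k) (by push_cast at h; omega)
  · have hn := nondegenerate_entry_three e
    refine ⟨hn, (noPrimitivePrime_three hn.coprime).mpr fun r hr hrF => ?_⟩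
    obtain ⟨k, hk⟩ := e.three_sub
    rw [prime_eq_of_dvd_pow hr Nat.prime_three (by exact_mod_cast hk) hrF]
  · cases e <;> cases e' <;>
      simp only [Entry.ab, Entry.q] at h1 h2 <;> subst h2 <;> simp only [add_left_inj] at h1
    · rfl
    · exact absurd h1.symm (one_lt_pow₀ (by norm_num) (Nat.ne_of_gt ‹0 < _›)).ne'
    · exact absurd h1 (one_lt_pow₀ (by norm_num) (Nat.ne_of_gt ‹0 < _›)).ne'
    · obtain rfl := Int.pow_right_injective (by norm_num) h1
      rfl
  · obtain ⟨k, hk⟩ := e.three_sub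
    obtain ⟨k', hk'⟩ := e'.three_sub
    have : (0 : ℤ) < 3 ^ k := by positivity
    have : (0 : ℤ) < 3 ^ k' := by positivity
    omega

theorem Entry.four_sub (e : Entry 4) : ∃ k : ℕ, e.ab.1 - 2 * e.q = 2 ^ k := by
  cases e with
  | four₁ q h => exact ⟨0, by simp [Entry.ab, Entry.q]⟩
  | four₂ k q hk hq h => exact ⟨k, by simp [Entry.ab, Entry.q]⟩

theorem exists_entry_four {p q : ℤ} (h : Nondegenerate p q) {k : ℕ} (hk : p - 2 * q = 2 ^ k) :
    ∃ e : Entry 4, e.ab.1 = p ∧ e.q = q := by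
  obtain ⟨hc, hp0, hq0, h1, h2, h3, h4⟩ := h
  obtain rfl : p = 2 ^ k + 2 * q := by omega
  rcases Nat.eq_zero_or_pos k with rfl | hk0
  · exact ⟨.four₁ q (by omega), by simp [Entry.ab], rfl⟩
  · have hq : ¬ (2 : ℤ) ∣ q := fun hq =>
      false_of_dvd_of_dvd Nat.prime_two hc ((dvd_pow_self _ hk0.ne').add (hq.mul_left 2)) hq
    have hkq : (k, q) ≠ (1, -1) := by
      rintro ⟨⟩
      norm_num at hp0
    have hkq' : (k, q) ≠ (1, 1) := by
      rintro ⟨⟩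
      norm_num at h4
    exact ⟨.four₂ k q hk0 hq ⟨hkq, hkq'⟩, rfl, rfl⟩

theorem nondegenerate_entry_four (e : Entry 4) : Nondegenerate e.ab.1 e.q := by
  cases e with
  | four₁ q h =>
    refine nondegenerate_of_coprime ?_ h.2.1 h.2.2 h.1
    exact ⟨1, -2, by simp only [Entry.ab, Entry.q]; ring⟩
  | four₂ k q hk hq h =>
    have hc := isCoprime_prime_pow_add Int.prime_two hq k 2
    simp only [Entry.ab, Entry.q]
    have hk1 : q = 1 ∨ q = -1 → 2 ≤ k := by
      intro hq1
      by_contra! hlt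
      obtain rfl : k = 1 := by omega
      rcases hq1 with rfl | rfl
      exacts [h.2 rfl, h.1 rfl]
    by_cases h1 : q = 1 ∨ q = -1
    · have h4 : (2 : ℤ) ^ 2 ≤ 2 ^ k := pow_le_pow_right₀ (by norm_num) (hk1 h1)
      exact ⟨hc, by omega, by omega, by omega, by omega, by omega, by omega⟩
    · exact nondegenerate_of_coprime hc (by rintro rfl; simp at hq) (by tauto) (by tauto)

theorem classification_four :
    (∀ p q : ℤ, Nondegenerate p q → NoPrimitivePrime 4 p q →
      (∃ e : Entry 4, e.ab.1 = p ∧ e.q = q) ∨ ∃ e : Entry 4, e.ab.1 = -p ∧ e.q = -q) ∧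
    (∀ e : Entry 4, Nondegenerate e.ab.1 e.q ∧ NoPrimitivePrime 4 e.ab.1 e.q) ∧
    (∀ e e' : Entry 4, e.ab.1 = e'.ab.1 → e.q = e'.q → e = e') ∧
    (∀ e e' : Entry 4, ¬ (e.ab.1 = -e'.ab.1 ∧ e.q = -e'.q)) := by
  refine ⟨fun p q hn hd => ?_, fun e => ?_, fun e e' h1 h2 => ?_, fun e e' h => ?_⟩
  · rw [noPrimitivePrime_four hn.coprime] at hd
    obtain ⟨k, hk⟩ := natAbs_eq_prime_pow (sub_ne_zero.mpr hn.ne_two) (l := 2) fun r hr hrF =>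
      (Nat.prime_dvd_prime_iff_eq hr Nat.prime_two).mp (hr.dvd_of_dvd_pow (n := 2) (hd r hr hrF))
    refine (eq_or_eq_neg_of_natAbs hk).imp (fun h => ?_) (fun h => ?_)
    · exact exists_entry_four hn (k := k) (by simpa using h)
    · exact exists_entry_four hn.neg (k := k) (by push_cast at h; omega)
  · have hn := nondegenerate_entry_four e
    refine ⟨hn, (noPrimitivePrime_four hn.coprime).mpr fun r hr hrF => ?_⟩
    obtain ⟨k, hk⟩ := e.four_sub
    rw [prime_eq_of_dvd_pow hr Nat.prime_two (by exact_mod_cast hk) hrF]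
    norm_num
  · cases e <;> cases e' <;>
      simp only [Entry.ab, Entry.q] at h1 h2 <;> subst h2 <;> simp only [add_left_inj] at h1
    · rfl
    · exact absurd h1.symm (one_lt_pow₀ (by norm_num) (Nat.ne_of_gt ‹0 < _›)).ne'
    · exact absurd h1 (one_lt_pow₀ (by norm_num) (Nat.ne_of_gt ‹0 < _›)).ne'
    · obtain rfl := Int.pow_right_injective (by norm_num) h1
      rfl
  · obtain ⟨k, hk⟩ := e.four_sub
    obtain ⟨k', hk'⟩ := e'.four_sub
    have : (0 : ℤ) < 2 ^ k := by positivity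
    have : (0 : ℤ) < 2 ^ k' := by positivity
    omega

/-- The exponents of `2` and `3` in `p - 3 q` for a table entry with `n = 6`. -/
def Entry.sixExponents : Entry 6 → ℕ × ℕ
  | .six₁ _ _ => (0, 0)
  | .six₂ l _ _ _ _ => (0, l)
  | .six₃ k _ _ _ _ => (k, 0)
  | .six₄ k l _ _ _ _ => (k, l)

theorem Entry.six_sub (e : Entry 6) :
    e.ab.1 - 3 * e.q = 2 ^ e.sixExponents.1 * 3 ^ e.sixExponents.2 := by
  cases e <;> simp [Entry.ab, Entry.q, Entry.sixExponents]

theorem two_pow_mul_three_pow_inj {k l k' l' : ℕ} (h : (2 : ℤ) ^ k * 3 ^ l = 2 ^ k' * 3 ^ l') :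
    k = k' ∧ l = l' := by
  have h' : 2 ^ k * 3 ^ l = 2 ^ k' * 3 ^ l' := by exact_mod_cast h
  have h2 := congrArg (fun m => m.factorization 2) h'
  have h3 := congrArg (fun m => m.factorization 3) h'
  simp [Nat.factorization_mul, Nat.prime_two.factorization, Nat.prime_three.factorization] at h2 h3
  exact ⟨h2, h3⟩

theorem exists_entry_six {p q : ℤ} (h : Nondegenerate p q) {k l : ℕ}
    (hkl : p - 3 * q = 2 ^ k * 3 ^ l) : ∃ e : Entry 6, e.ab.1 = p ∧ e.q = q := by
  obtain ⟨hc, hp0, hq0, h1, h2, h3, h4⟩ := h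
  obtain rfl : p = 2 ^ k * 3 ^ l + 3 * q := by omega
  have hq2 : 0 < k → ¬ (2 : ℤ) ∣ q := fun hk hq => false_of_dvd_of_dvd Nat.prime_two hc
    (((dvd_pow_self _ hk.ne').mul_right _).add (hq.mul_left 3)) hq
  have hq3 : 0 < l → ¬ (3 : ℤ) ∣ q := fun hl hq => false_of_dvd_of_dvd Nat.prime_three hc
    (((dvd_pow_self _ hl.ne').mul_left _).add (hq.mul_left 3)) hq
  rcases Nat.eq_zero_or_pos k with rfl | hk <;> rcases Nat.eq_zero_or_pos l with rfl | hl
  · exact ⟨.six₁ q (by omega), by simp [Entry.ab], rfl⟩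
  · have hlq : (l, q) ≠ (1, -1) := by
      rintro ⟨⟩
      norm_num at hp0
    exact ⟨.six₂ l q hl (hq3 hl) hlq, by simp [Entry.ab], rfl⟩
  · have hkq : (k, q) ≠ (1, -1) := by
      rintro ⟨⟩
      norm_num at h1
    exact ⟨.six₃ k q hk (hq2 hk) hkq, by simp [Entry.ab], rfl⟩
  · have hq : IsCoprime 6 q := IsCoprime.mul_left (x := (2 : ℤ)) (y := 3)
      ((Prime.coprime_iff_not_dvd Int.prime_two).mpr (hq2 hk))
      ((Prime.coprime_iff_not_dvd Int.prime_three).mpr (hq3 hl))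
    exact ⟨.six₄ k l q hk hl hq, rfl, rfl⟩

theorem nondegenerate_entry_six (e : Entry 6) : Nondegenerate e.ab.1 e.q := by
  cases e with
  | six₁ q h =>
    refine nondegenerate_of_coprime ?_ h.2.1 h.2.2 h.1
    exact ⟨1, -3, by simp only [Entry.ab, Entry.q]; ring⟩
  | six₂ k q hk hq h =>
    have hc := isCoprime_prime_pow_add Int.prime_three hq k 3
    simp only [Entry.ab, Entry.q]
    have h3 : (3 : ℤ) ^ 1 ≤ 3 ^ k := pow_le_pow_right₀ (by norm_num) hk
    by_cases h1 : q = 1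
    · subst h1
      exact ⟨hc, by omega, by omega, by omega, by omega, by omega, by omega⟩
    by_cases h2 : q = -1
    · subst h2
      have hk1 : 2 ≤ k := by
        by_contra! hlt
        exact h (by rw [show k = 1 by omega])
      have h9 : (3 : ℤ) ^ 2 ≤ 3 ^ k := pow_le_pow_right₀ (by norm_num) hk1
      exact ⟨hc, by omega, by omega, by omega, by omega, by omega, by omega⟩
    · exact nondegenerate_of_coprime hc (by rintro rfl; simp at hq) h1 h2
  | six₃ k q hk hq h =>
    have hc := isCoprime_prime_pow_add Int.prime_two hq k 3
    simp only [Entry.ab, Entry.q]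
    have h3 : (2 : ℤ) ^ 1 ≤ 2 ^ k := pow_le_pow_right₀ (by norm_num) hk
    by_cases h1 : q = 1
    · subst h1
      exact ⟨hc, by omega, by omega, by omega, by omega, by omega, by omega⟩
    by_cases h2 : q = -1
    · subst h2
      have hk1 : 2 ≤ k := by
        by_contra! hlt
        exact h (by rw [show k = 1 by omega])
      have h9 : (2 : ℤ) ^ 2 ≤ 2 ^ k := pow_le_pow_right₀ (by norm_num) hk1
      exact ⟨hc, by omega, by omega, by omega, by omega, by omega, by omega⟩
    · exact nondegenerate_of_coprime hc (by rintro rfl; simp at hq) h1 h2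
  | six₄ k l q hk hl hq =>
    simp only [Entry.ab, Entry.q]
    have hc : IsCoprime ((2 : ℤ) ^ k * 3 ^ l + 3 * q) q := by
      refine (IsCoprime.add_mul_right_left_iff (z := 3)).mpr (IsCoprime.mul_left ?_ ?_)
      · exact (hq.of_isCoprime_of_dvd_left ⟨3, by norm_num⟩).pow_left
      · exact (hq.of_isCoprime_of_dvd_left ⟨2, by norm_num⟩).pow_left
    have h6 : (2 : ℤ) ^ 1 * 3 ^ 1 ≤ 2 ^ k * 3 ^ l :=
      mul_le_mul (pow_le_pow_right₀ (by norm_num) hk) (pow_le_pow_right₀ (by norm_num) hl)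
        (by norm_num) (by positivity)
    generalize (2 : ℤ) ^ k * 3 ^ l = m at *
    have h0 : q ≠ 0 := by
      rintro rfl
      rw [isCoprime_zero_right, Int.isUnit_iff] at hq
      omega
    by_cases h1 : q = 1 ∨ q = -1
    · exact ⟨hc, by omega, by omega, by omega, by omega, by omega, by omega⟩
    · exact nondegenerate_of_coprime hc h0 (by tauto) (by tauto)

theorem classification_six :
    (∀ p q : ℤ, Nondegenerate p q → NoPrimitivePrime 6 p q →
      (∃ e : Entry 6, e.ab.1 = p ∧ e.q = q) ∨ ∃ e : Entry 6, e.ab.1 = -p ∧ e.q = -q) ∧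
    (∀ e : Entry 6, Nondegenerate e.ab.1 e.q ∧ NoPrimitivePrime 6 e.ab.1 e.q) ∧
    (∀ e e' : Entry 6, e.ab.1 = e'.ab.1 → e.q = e'.q → e = e') ∧
    (∀ e e' : Entry 6, ¬ (e.ab.1 = -e'.ab.1 ∧ e.q = -e'.q)) := by
  refine ⟨fun p q hn hd => ?_, fun e => ?_, fun e e' h1 h2 => ?_, fun e e' h => ?_⟩
  · rw [noPrimitivePrime_six hn.coprime] at hd
    obtain ⟨k, l, hkl⟩ := exists_eq_two_pow_mul_three_pow
      (Int.natAbs_ne_zero.mpr (sub_ne_zero.mpr hn.ne_three)) fun r hr hrF =>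
        (hr.dvd_mul.mp (show r ∣ 2 * 3 from hd r hr (Int.natCast_dvd.mpr hrF))).imp
          (Nat.prime_dvd_prime_iff_eq hr Nat.prime_two).mp
          (Nat.prime_dvd_prime_iff_eq hr Nat.prime_three).mp
    refine (eq_or_eq_neg_of_natAbs hkl).imp (fun h => ?_) (fun h => ?_)
    · exact exists_entry_six hn (k := k) (l := l) (by simpa using h)
    · exact exists_entry_six hn.neg (k := k) (l := l) (by push_cast at h; omega)
  · have hn := nondegenerate_entry_six e
    refine ⟨hn, (noPrimitivePrime_six hn.coprime).mpr fun r hr hrF => ?_⟩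
    rw [e.six_sub] at hrF
    rcases (Nat.prime_iff_prime_int.mp hr).dvd_or_dvd hrF with h | h
    · rw [prime_eq_of_dvd_pow hr Nat.prime_two rfl h]
      norm_num
    · rw [prime_eq_of_dvd_pow hr Nat.prime_three rfl h]
      norm_num
  · obtain ⟨hk, hl⟩ : e.sixExponents.1 = e'.sixExponents.1 ∧
        e.sixExponents.2 = e'.sixExponents.2 := by
      apply two_pow_mul_three_pow_inj
      rw [← e.six_sub, ← e'.six_sub, h1, h2]
    cases e <;> cases e' <;> simp only [Entry.sixExponents, Entry.q] at hk hl h2 <;>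
      first | omega | (subst_vars; rfl)
  · have := e.six_sub
    have := e'.six_sub
    have : (0 : ℤ) < 2 ^ e.sixExponents.1 * 3 ^ e.sixExponents.2 := by positivity
    have : (0 : ℤ) < 2 ^ e'.sixExponents.1 * 3 ^ e'.sixExponents.2 := by positivity
    omega

/-! ### The quadratic cases `n = 5, 10, 8, 12` -/

theorem abs_eq_one_or_of_dvd_prime {F : ℤ} {l : ℕ} (hl : l.Prime) (h : F ∣ l) :
    |F| = 1 ∨ |F| = l := by
  rcases (Nat.dvd_prime hl).mp (Int.natAbs_dvd_natAbs.mpr h) with h | h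
  · exact Or.inl (by rw [Int.abs_eq_natAbs, h, Nat.cast_one])
  · exact Or.inr (by rw [Int.abs_eq_natAbs, h])

theorem exists_entry_five {p q : ℤ} (h : Nondegenerate p q) (hq : 0 < q)
    (hF : p ^ 2 - 3 * p * q + q ^ 2 ∣ 5) : ∃ e : Entry 5, e.ab.1 = p ∧ e.q = q := by
  obtain ⟨-, hp0, hq0, h1, h2, h3, h4⟩ := h
  have ha := abs_eq_one_or_of_dvd_prime Nat.prime_five (by exact_mod_cast hF)
  push_cast at ha
  -- `p ↦ 3 q - p` preserves the norm, so it is enough to solve for `u = q - p` or `u = p - 2 q`.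
  obtain ⟨u, ε, hu, hε, hp⟩ | ⟨rfl, rfl⟩ : (∃ u ε : ℤ, 0 ≤ u ∧ (ε = 1 ∨ ε = -1) ∧
      (ε = 1 ∧ p = q - u ∨ ε = -1 ∧ p = 2 * q + u)) ∨ (p = 3 ∧ q = 2) := by
    rcases le_or_gt p q with hpq | hpq
    · exact Or.inl ⟨q - p, 1, by omega, by omega, by omega⟩
    rcases le_or_gt (2 * q) p with hpq' | hpq'
    · exact Or.inl ⟨p - 2 * q, -1, by omega, by omega, by omega⟩
    right
    have hlow := Int.le_of_dvd (by norm_num) (neg_dvd.mpr hF)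
    have hpos := mul_pos (sub_pos.mpr hpq) (sub_pos.mpr hpq')
    have hq2 : q ≤ 2 := by nlinarith
    omega
  · have hN : |p ^ 2 - 3 * p * q + q ^ 2| = |q ^ 2 - u * q - u ^ 2| := by
      rw [← abs_neg]
      congr 1
      rcases hp with ⟨-, rfl⟩ | ⟨-, rfl⟩ <;> ring
    rw [hN] at ha
    rcases ha with ha | ha
    · obtain ⟨k, rfl, rfl⟩ := exists_phi hu hq.le ha
      have hk : 3 ≤ k := by
        by_contra! hlt
        have e0 : phi ((0 : ℕ) : ℤ) = 0 := by decide
        have e1 : phi ((1 : ℕ) : ℤ) = 1 := by decide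
        have e1' : phi ((1 : ℕ) - 1 : ℤ) = 0 := by decide
        have e2 : phi ((2 : ℕ) : ℤ) = 1 := by decide
        have e2' : phi ((2 : ℕ) - 1 : ℤ) = 1 := by decide
        interval_cases k <;> omega
      refine ⟨.five₁ k ε hε hk, ?_, rfl⟩
      rcases hp with ⟨rfl, rfl⟩ | ⟨rfl, rfl⟩
      · simpa [Entry.ab] using phi_sub_two k
      · simpa [Entry.ab] using phi_add_two k
    · obtain ⟨k, rfl, rfl⟩ := exists_psi hu hq.le ha
      have hk : (k, ε) ≠ (0, -1) ∧ (k, ε) ≠ (1, -1) := by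
        have e0 : psi ((0 : ℕ) - 1 : ℤ) = -1 := by decide
        have e1 : psi ((1 : ℕ) : ℤ) = 1 := by decide
        have e1' : psi ((1 : ℕ) - 1 : ℤ) = 2 := by decide
        constructor <;> rintro ⟨⟩ <;> omega
      refine ⟨.five₂ k ε hε hk, ?_, rfl⟩
      rcases hp with ⟨rfl, rfl⟩ | ⟨rfl, rfl⟩
      · simpa [Entry.ab] using psi_sub_two k
      · simpa [Entry.ab] using psi_add_two k
  · exact ⟨.five₂ 0 1 (Or.inl rfl) (by decide), by decide, by decide⟩

theorem phi_sub_two_mul (k : ℕ) {ε : ℤ} (hε : ε = 1 ∨ ε = -1) :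
    phi (k - 2 * ε) = phi k - phi (k - 1) ∨ phi (k - 2 * ε) = 2 * phi k + phi (k - 1) := by
  rcases hε with rfl | rfl
  · exact Or.inl (by simpa using phi_sub_two k)
  · exact Or.inr (by simpa using phi_add_two k)

theorem psi_sub_two_mul (k : ℕ) {ε : ℤ} (hε : ε = 1 ∨ ε = -1) :
    psi (k - 2 * ε) = psi k - psi (k - 1) ∨ psi (k - 2 * ε) = 2 * psi k + psi (k - 1) := by
  rcases hε with rfl | rfl
  · exact Or.inl (by simpa using psi_sub_two k)
  · exact Or.inr (by simpa using psi_add_two k)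

theorem Entry.five_q_pos (e : Entry 5) : 0 < e.q := by
  cases e with
  | five₁ k ε hε hk => exact zero_lt_two.trans_le (two_le_phi hk)
  | five₂ k ε hε h => exact (psi_pos k).2

/-- The values `y - u = x_{k-2}` and `2 y + u = x_{k+2}`, for a Fibonacci-type sequence with
`u = x_{k-1}`, `y = x_k`, have the same norm relative to `y`. -/
theorem coprime_and_norm {p u y c : ℤ} (hp : p = y - u ∨ p = 2 * y + u)
    (h : IsCoprime u y ∧ |y ^ 2 - u * y - u ^ 2| = c) :
    IsCoprime p y ∧ |p ^ 2 - 3 * p * y + y ^ 2| = c := by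
  obtain ⟨⟨a, b, hab⟩, h⟩ := h
  rw [← h, ← abs_neg]
  rcases hp with rfl | rfl
  · exact ⟨⟨-a, a + b, by linear_combination hab⟩, by congr 1; ring⟩
  · exact ⟨⟨a, b - 2 * a, by linear_combination hab⟩, by congr 1; ring⟩

theorem coprime_and_norm_phi (k : ℕ) {ε : ℤ} (hε : ε = 1 ∨ ε = -1) :
    IsCoprime (phi (k - 2 * ε)) (phi k) ∧
      |phi (k - 2 * ε) ^ 2 - 3 * phi (k - 2 * ε) * phi k + phi k ^ 2| = 1 :=
  coprime_and_norm (phi_sub_two_mul k hε) (phi_norm k)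

theorem coprime_and_norm_psi (k : ℕ) {ε : ℤ} (hε : ε = 1 ∨ ε = -1) :
    IsCoprime (psi (k - 2 * ε)) (psi k) ∧
      |psi (k - 2 * ε) ^ 2 - 3 * psi (k - 2 * ε) * psi k + psi k ^ 2| = 5 :=
  coprime_and_norm (psi_sub_two_mul k hε) (psi_norm k)

theorem Entry.five_valid (e : Entry 5) : Nondegenerate e.ab.1 e.q ∧
    e.ab.1 ^ 2 - 3 * e.ab.1 * e.q + e.q ^ 2 ∣ 5 := by
  cases e with
  | five₁ k ε hε hk =>
    obtain ⟨hc, hN⟩ := coprime_and_norm_phi k hε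
    have := two_le_phi hk
    refine ⟨nondegenerate_of_coprime hc ?_ ?_ ?_, ?_⟩
    iterate 3 simp only [Entry.q]; omega
    rw [← abs_dvd]
    exact hN ▸ one_dvd 5
  | five₂ k ε hε h =>
    obtain ⟨hc, hN⟩ := coprime_and_norm_psi k hε
    refine ⟨?_, by rw [← abs_dvd]; exact hN ▸ dvd_rfl⟩
    by_cases hk : k = 1
    · subst hk
      obtain rfl : ε = 1 := hε.resolve_right fun h' => h.2 (by rw [h'])
      have e1 : psi ((1 : ℕ) : ℤ) = 1 := by decide
      have e2 : psi ((1 : ℕ) - 2 * 1 : ℤ) = -1 := by decide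
      simp only [Entry.ab, Entry.q, e1, e2] at hc ⊢
      exact ⟨hc, by omega, by omega, by omega, by omega, by omega, by omega⟩
    · have h1 := (psi_pos k).2
      have h2 : psi k ≠ 1 := fun h =>
        hk (psi_injective (h.trans (by decide : (1 : ℤ) = psi (1 : ℕ))))
      refine nondegenerate_of_coprime hc ?_ ?_ ?_ <;> simp only [Entry.q] <;> omega

theorem Entry.five_inj (e e' : Entry 5) (h1 : e.ab.1 = e'.ab.1) (h2 : e.q = e'.q) : e = e' := by
  have hphi : ∀ k : ℕ, 3 ≤ k → phi (k + 2) ≠ phi (k - 2) := fun k hk => by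
    have := phi_add_two k
    have := phi_sub_two k
    have := two_le_phi hk
    have := phi_nonneg k
    omega
  have hpsi : ∀ k : ℕ, 2 ≤ k → psi (k + 2) ≠ psi (k - 2) := fun k hk => by
    have h1 := psi_add_two k
    have h2 := psi_sub_two k
    obtain ⟨k, rfl⟩ := Nat.exists_eq_add_of_le' (show 1 ≤ k by omega)
    have := psi_pos k
    push_cast at h1 h2 ⊢
    rw [add_sub_cancel_right] at h1 h2
    omega
  cases e with
  | five₁ k ε hε hk =>
    cases e' with
    | five₁ k' ε' hε' hk' =>
      obtain rfl := phi_injOn (by omega) (by omega) h2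
      simp only [Entry.ab] at h1
      rcases hε with rfl | rfl <;> rcases hε' with rfl | rfl <;> first
        | rfl
        | (exact absurd (by simpa using h1) (hphi k hk))
        | (exact absurd (by simpa using h1.symm) (hphi k hk))
    | five₂ k' ε' hε' h' =>
      have hN := (coprime_and_norm_phi k hε).2
      have hN' := (coprime_and_norm_psi k' hε').2
      simp only [Entry.ab, Entry.q] at h1 h2
      rw [h1, h2, hN'] at hN
      norm_num at hN
  | five₂ k ε hε h =>
    cases e' with
    | five₁ k' ε' hε' hk' =>
      have hN := (coprime_and_norm_psi k hε).2
      have hN' := (coprime_and_norm_phi k' hε').2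
      simp only [Entry.ab, Entry.q] at h1 h2
      rw [h1, h2, hN'] at hN
      norm_num at hN
    | five₂ k' ε' hε' h' =>
      obtain rfl := psi_injective h2
      have hk : ε = -1 ∨ ε' = -1 → 2 ≤ k := by
        intro hor
        by_contra! hlt
        interval_cases k <;> rcases hor with rfl | rfl <;> simp at h h'
      simp only [Entry.ab] at h1
      rcases hε with rfl | rfl <;> rcases hε' with rfl | rfl <;> first
        | rfl
        | (exact absurd (by simpa using h1) (hpsi k (hk (by simp))))
        | (exact absurd (by simpa using h1.symm) (hpsi k (hk (by simp))))

theorem classification_five :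
    (∀ p q : ℤ, Nondegenerate p q → NoPrimitivePrime 5 p q →
      (∃ e : Entry 5, e.ab.1 = p ∧ e.q = q) ∨ ∃ e : Entry 5, e.ab.1 = -p ∧ e.q = -q) ∧
    (∀ e : Entry 5, Nondegenerate e.ab.1 e.q ∧ NoPrimitivePrime 5 e.ab.1 e.q) ∧
    (∀ e e' : Entry 5, e.ab.1 = e'.ab.1 → e.q = e'.q → e = e') ∧
    (∀ e e' : Entry 5, ¬ (e.ab.1 = -e'.ab.1 ∧ e.q = -e'.q)) := by
  refine ⟨fun p q hn hd => ?_, fun e => ?_, Entry.five_inj, fun e e' h => ?_⟩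
  · rw [noPrimitivePrime_five hn.coprime] at hd
    rcases lt_or_gt_of_ne hn.q_ne with hq | hq
    · exact Or.inr (exists_entry_five hn.neg (neg_pos.mpr hq) (by convert hd using 1; ring))
    · exact Or.inl (exists_entry_five hn hq hd)
  · obtain ⟨hn, hd⟩ := e.five_valid
    exact ⟨hn, (noPrimitivePrime_five hn.coprime).mpr hd⟩
  · have := e.five_q_pos
    have := e'.five_q_pos
    omega

/-- The entries for `n = 5` and `n = 10` correspond under `(a, b) ↦ (b, a)`. -/
def Entry.tenOfFive : Entry 5 → Entry 10
  | .five₁ k ε hε hk => .ten₁ k ε hε hk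
  | .five₂ k ε hε h => .ten₂ k ε hε h

theorem Entry.tenOfFive_surjective : Function.Surjective Entry.tenOfFive := by
  intro e
  cases e with
  | ten₁ k ε hε hk => exact ⟨.five₁ k ε hε hk, rfl⟩
  | ten₂ k ε hε h => exact ⟨.five₂ k ε hε h, rfl⟩

theorem Entry.tenOfFive_ab (e : Entry 5) :
    e.tenOfFive.ab.1 = e.ab.1 - 4 * e.q ∧ e.tenOfFive.q = -e.q := by
  cases e <;> exact ⟨rfl, rfl⟩

theorem classification_ten :
    (∀ p q : ℤ, Nondegenerate p q → NoPrimitivePrime 10 p q →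
      (∃ e : Entry 10, e.ab.1 = p ∧ e.q = q) ∨ ∃ e : Entry 10, e.ab.1 = -p ∧ e.q = -q) ∧
    (∀ e : Entry 10, Nondegenerate e.ab.1 e.q ∧ NoPrimitivePrime 10 e.ab.1 e.q) ∧
    (∀ e e' : Entry 10, e.ab.1 = e'.ab.1 → e.q = e'.q → e = e') ∧
    (∀ e e' : Entry 10, ¬ (e.ab.1 = -e'.ab.1 ∧ e.q = -e'.q)) := by
  have hex : ∀ p q : ℤ, Nondegenerate p q → p ^ 2 - 5 * p * q + 5 * q ^ 2 ∣ 5 → q < 0 →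
      ∃ e : Entry 10, e.ab.1 = p ∧ e.q = q := by
    intro p q hn hd hq
    obtain ⟨e, h1, h2⟩ := exists_entry_five hn.conj (neg_pos.mpr hq) (by
      convert hd using 1; ring)
    obtain ⟨h3, h4⟩ := e.tenOfFive_ab
    exact ⟨e.tenOfFive, by omega, by omega⟩
  refine ⟨fun p q hn hd => ?_, fun e => ?_, fun e e' h1 h2 => ?_, fun e e' h => ?_⟩
  · rw [noPrimitivePrime_ten hn.coprime] at hd
    rcases lt_or_gt_of_ne hn.q_ne with hq | hq
    · exact Or.inl (hex p q hn hd hq)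
    · exact Or.inr (hex _ _ hn.neg (by convert hd using 1; ring) (neg_neg_iff_pos.mpr hq))
  · obtain ⟨e, rfl⟩ := Entry.tenOfFive_surjective e
    obtain ⟨hn, hd⟩ := e.five_valid
    obtain ⟨h1, h2⟩ := e.tenOfFive_ab
    rw [h1, h2, noPrimitivePrime_ten hn.conj.coprime]
    exact ⟨hn.conj, by convert hd using 1; ring⟩
  · obtain ⟨e, rfl⟩ := Entry.tenOfFive_surjective e
    obtain ⟨e', rfl⟩ := Entry.tenOfFive_surjective e'
    obtain ⟨h3, h4⟩ := e.tenOfFive_ab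
    obtain ⟨h5, h6⟩ := e'.tenOfFive_ab
    rw [Entry.five_inj e e' (by omega) (by omega)]
  · obtain ⟨e, rfl⟩ := Entry.tenOfFive_surjective e
    obtain ⟨e', rfl⟩ := Entry.tenOfFive_surjective e'
    have := e.five_q_pos
    have := e'.five_q_pos
    have := e.tenOfFive_ab.2
    have := e'.tenOfFive_ab.2
    omega

theorem exists_entry_eight {p q : ℤ} (h : Nondegenerate p q) (hq : 0 < q)
    (hF : p ^ 2 - 4 * p * q + 2 * q ^ 2 ∣ 2) : ∃ e : Entry 8, e.ab.1 = p ∧ e.q = q := by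
  obtain ⟨-, hp0, hq0, h1, h2, h3, h4⟩ := h
  have ha := abs_eq_one_or_of_dvd_prime Nat.prime_two (by exact_mod_cast hF)
  push_cast at ha
  have e0 : pell ((0 : ℕ) : ℤ) = 0 := by decide
  have e0' : rho ((0 : ℕ) : ℤ) = 1 := by decide
  have e1 : pell ((1 : ℕ) : ℤ) = 1 := by decide
  have e1' : rho ((1 : ℕ) : ℤ) = 1 := by decide
  rcases ha with ha | ha
  · obtain ⟨k, hx, rfl⟩ := exists_pell (abs_nonneg (p - 2 * q)) hq.le (by
      rw [sq_abs, ← ha]; congr 1; ring)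
    have hp := eq_or_eq_neg_of_abs_eq hx
    have hk : 2 ≤ k := by
      by_contra! hlt
      interval_cases k <;> omega
    obtain ⟨-, r1, -, r2⟩ := pell_rho_shift k
    rcases hp with hp | hp
    · refine ⟨.eight₁ k (-1) (Or.inr rfl) hk, ?_, rfl⟩
      simp only [Entry.ab, sub_neg_eq_add]
      omega
    · refine ⟨.eight₁ k 1 (Or.inl rfl) hk, ?_, rfl⟩
      simp only [Entry.ab]
      omega
  · -- Here `p` is even, and `q² - 2 (p / 2 - q)² = ∓ 1`.
    obtain ⟨m, rfl⟩ : (2 : ℤ) ∣ p := by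
      have h2 : (2 : ℤ) ∣ p ^ 2 - 4 * p * q + 2 * q ^ 2 := (dvd_abs _ _).mp (by rw [ha])
      refine Int.prime_two.dvd_of_dvd_pow (n := 2) ?_
      have e : p ^ 2 = p ^ 2 - 4 * p * q + 2 * q ^ 2 + 2 * (2 * p * q - q ^ 2) := by ring
      exact e ▸ h2.add (dvd_mul_right _ _)
    obtain ⟨k, rfl, hy⟩ := exists_pell hq.le (abs_nonneg (m - q)) (by
      have e : (2 * m) ^ 2 - 4 * (2 * m) * q + 2 * q ^ 2 = (-2) * (q ^ 2 - 2 * (m - q) ^ 2) := by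
        ring
      rw [e, abs_mul] at ha
      norm_num at ha
      rwa [sq_abs])
    have hm := eq_or_eq_neg_of_abs_eq hy
    have hk : 2 ≤ k := by
      by_contra! hlt
      interval_cases k <;> omega
    obtain ⟨r1, -, r2, -⟩ := pell_rho_shift k
    rcases hm with hm | hm
    · refine ⟨.eight₂ k (-1) (Or.inr rfl) hk, ?_, rfl⟩
      simp only [Entry.ab, sub_neg_eq_add]
      omega
    · refine ⟨.eight₂ k 1 (Or.inl rfl) hk, ?_, rfl⟩
      simp only [Entry.ab]
      omega

theorem rho_sub (k : ℕ) {ε : ℤ} (hε : ε = 1 ∨ ε = -1) :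
    rho (k - ε) = 2 * pell k - ε * rho k ∧ pell (k - ε) = rho k - ε * pell k := by
  obtain ⟨r1, r2, r3, r4⟩ := pell_rho_shift k
  rcases hε with rfl | rfl
  · omega
  · rw [sub_neg_eq_add]
    omega

theorem isCoprime_of_abs_eq_one {x y a b : ℤ} (h : |a * x + b * y| = 1) : IsCoprime x y := by
  rcases (abs_eq zero_le_one).mp h with h | h
  · exact ⟨a, b, h⟩
  · exact ⟨-a, -b, by linear_combination -h⟩

theorem norm_eight₁ (k : ℕ) {ε : ℤ} (hε : ε = 1 ∨ ε = -1) :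
    |rho (k - ε) ^ 2 - 4 * rho (k - ε) * pell k + 2 * pell k ^ 2| = 1 := by
  rw [(rho_sub k hε).1]
  refine Eq.trans ?_ (pell_norm k).1
  congr 1
  rcases hε with rfl | rfl <;> ring

theorem norm_eight₂ (k : ℕ) {ε : ℤ} (hε : ε = 1 ∨ ε = -1) :
    |2 * pell (k - ε) ^ 2 - 4 * pell (k - ε) * rho k + rho k ^ 2| = 1 := by
  rw [(rho_sub k hε).2]
  refine Eq.trans ?_ (pell_norm k).1
  rw [← abs_neg]
  congr 1
  rcases hε with rfl | rfl <;> ring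

theorem Entry.eight_valid (e : Entry 8) : Nondegenerate e.ab.1 e.q ∧
    e.ab.1 ^ 2 - 4 * e.ab.1 * e.q + 2 * e.q ^ 2 ∣ 2 := by
  cases e with
  | eight₁ k ε hε hk =>
    have hN := norm_eight₁ k hε
    have := two_le_pell_rho hk
    simp only [Entry.ab, Entry.q]
    refine ⟨nondegenerate_of_coprime (isCoprime_of_abs_eq_one (a := rho (k - ε))
      (b := 2 * pell k - 4 * rho (k - ε)) ?_) (by omega) (by omega) (by omega), ?_⟩
    · rw [← hN]
      congr 1
      ring
    · rw [← abs_dvd, hN]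
      exact one_dvd 2
  | eight₂ k ε hε hk =>
    have hN := norm_eight₂ k hε
    have := two_le_pell_rho hk
    simp only [Entry.ab, Entry.q]
    refine ⟨nondegenerate_of_coprime (isCoprime_of_abs_eq_one (a := pell (k - ε))
      (b := rho k - 4 * pell (k - ε)) ?_) (by omega) (by omega) (by omega), ?_⟩
    · rw [← hN]
      congr 1
      ring
    · have e : (2 * pell (k - ε)) ^ 2 - 4 * (2 * pell (k - ε)) * rho k + 2 * rho k ^ 2 =
          2 * (2 * pell (k - ε) ^ 2 - 4 * pell (k - ε) * rho k + rho k ^ 2) := by ring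
      rw [e, ← abs_dvd, abs_mul, hN]
      norm_num

theorem Entry.eight_q_pos (e : Entry 8) : 0 < e.q := by
  cases e with
  | eight₁ k ε hε hk => exact zero_lt_two.trans_le (two_le_pell_rho hk).1
  | eight₂ k ε hε hk => exact zero_lt_two.trans_le (two_le_pell_rho hk).2

theorem Entry.eight_inj (e e' : Entry 8) (h1 : e.ab.1 = e'.ab.1) (h2 : e.q = e'.q) : e = e' := by
  have parity : ∀ (k k' : ℕ) (ε ε' : ℤ), (ε = 1 ∨ ε = -1) → rho (k - ε) ≠ 2 * pell (k' - ε') := by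
    intro k k' ε ε' hε h
    have hN := norm_eight₁ k hε
    rw [h] at hN
    have h2 : (2 : ℤ) ∣ 1 := by
      rw [← hN, dvd_abs]
      exact ⟨2 * pell (k' - ε') ^ 2 - 4 * pell (k' - ε') * pell k + pell k ^ 2, by ring⟩
    norm_num at h2
  cases e with
  | eight₁ k ε hε hk =>
    cases e' with
    | eight₁ k' ε' hε' hk' =>
      obtain rfl := pell_strictMono.injective h2
      simp only [Entry.ab, (rho_sub k hε).1, (rho_sub k hε').1] at h1
      have := two_le_pell_rho hk
      obtain rfl : ε = ε' := by rcases hε with rfl | rfl <;> rcases hε' with rfl | rfl <;> omega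
      rfl
    | eight₂ k' ε' hε' hk' => exact absurd h1 (parity k k' ε ε' hε)
  | eight₂ k ε hε hk =>
    cases e' with
    | eight₁ k' ε' hε' hk' => exact absurd h1.symm (parity k' k ε' ε hε')
    | eight₂ k' ε' hε' hk' =>
      obtain rfl := rho_injOn (by omega) (by omega) h2
      simp only [Entry.ab, (rho_sub k hε).2, (rho_sub k hε').2] at h1
      have := two_le_pell_rho hk
      obtain rfl : ε = ε' := by rcases hε with rfl | rfl <;> rcases hε' with rfl | rfl <;> omega
      rfl

theorem classification_eight :
    (∀ p q : ℤ, Nondegenerate p q → NoPrimitivePrime 8 p q →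
      (∃ e : Entry 8, e.ab.1 = p ∧ e.q = q) ∨ ∃ e : Entry 8, e.ab.1 = -p ∧ e.q = -q) ∧
    (∀ e : Entry 8, Nondegenerate e.ab.1 e.q ∧ NoPrimitivePrime 8 e.ab.1 e.q) ∧
    (∀ e e' : Entry 8, e.ab.1 = e'.ab.1 → e.q = e'.q → e = e') ∧
    (∀ e e' : Entry 8, ¬ (e.ab.1 = -e'.ab.1 ∧ e.q = -e'.q)) := by
  refine ⟨fun p q hn hd => ?_, fun e => ?_, Entry.eight_inj, fun e e' h => ?_⟩
  · rw [noPrimitivePrime_eight hn.coprime] at hd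
    rcases lt_or_gt_of_ne hn.q_ne with hq | hq
    · exact Or.inr (exists_entry_eight hn.neg (neg_pos.mpr hq) (by convert hd using 1; ring))
    · exact Or.inl (exists_entry_eight hn hq hd)
  · obtain ⟨hn, hd⟩ := e.eight_valid
    exact ⟨hn, (noPrimitivePrime_eight hn.coprime).mpr hd⟩
  · have := e.eight_q_pos
    have := e'.eight_q_pos
    omega

theorem exists_entry_twelve {p q : ℤ} (h : Nondegenerate p q) (hq : 0 < q)
    (hF : p ^ 2 - 4 * p * q + q ^ 2 ∣ 6) : ∃ e : Entry 12, e.ab.1 = p ∧ e.q = q := by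
  obtain ⟨-, hp0, hq0, h1, h2, h3, h4⟩ := h
  -- `p ↦ 4 q - p` preserves the norm.
  obtain ⟨a, ε, ha, hε, hN, hp⟩ : ∃ a ε : ℤ, a ≤ 2 * q ∧ (ε = 1 ∨ ε = -1) ∧
      a ^ 2 - 4 * a * q + q ^ 2 ∣ 6 ∧ (ε = 1 ∧ p = a ∨ ε = -1 ∧ p = 4 * q - a) := by
    rcases le_or_gt p (2 * q) with hpq | hpq
    · exact ⟨p, 1, hpq, by omega, hF, by omega⟩
    · exact ⟨4 * q - p, -1, by omega, by omega, by convert hF using 1; ring, by omega⟩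
  obtain ⟨i, k, rfl, rfl⟩ := exists_zeta hq ha hN
  have hik : (i, k) ≠ (0, 0) ∧ (i, k) ≠ (0, 1) ∧ (i, k) ≠ (1, 0) ∧ (i, k) ≠ (2, 0) := by
    have e00 : zeta 0 ((0 : ℕ) : ℤ) = 0 := by decide
    have e01 : zeta 0 ((1 : ℕ) : ℤ) = 1 := by decide
    have e01' : zeta 0 ((1 : ℕ) - 1 : ℤ) = 0 := by decide
    have e10 : zeta 1 ((0 : ℕ) : ℤ) = 1 := by decide
    have e10' : zeta 1 ((0 : ℕ) - 1 : ℤ) = 2 := by decide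
    have e20 : zeta 2 ((0 : ℕ) : ℤ) = 1 := by decide
    have e20' : zeta 2 ((0 : ℕ) - 1 : ℤ) = 1 := by decide
    refine ⟨?_, ?_, ?_, ?_⟩ <;> rintro ⟨⟩ <;> omega
  refine ⟨.twelve i k ε hε hik, ?_, rfl⟩
  rcases hp with ⟨rfl, rfl⟩ | ⟨rfl, rfl⟩
  · rfl
  · simpa [Entry.ab] using zeta_succ i k

theorem zeta_sub (i : Fin 4) (k : ℕ) {ε : ℤ} (hε : ε = 1 ∨ ε = -1) :
    zeta i (k - ε) = zeta i (k - 1) ∨ zeta i (k - ε) = 4 * zeta i k - zeta i (k - 1) := by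
  rcases hε with rfl | rfl
  · exact Or.inl rfl
  · exact Or.inr (by simpa using zeta_succ i k)

theorem coprime_and_norm_zeta (i : Fin 4) (k : ℕ) {ε : ℤ} (hε : ε = 1 ∨ ε = -1) :
    IsCoprime (zeta i (k - ε)) (zeta i k) ∧
    zeta i (k - ε) ^ 2 - 4 * zeta i (k - ε) * zeta i k + zeta i k ^ 2 = zetaNorm i := by
  obtain ⟨⟨a, b, hab⟩, hN⟩ := zeta_norm i k
  rcases zeta_sub i k hε with h | h <;> rw [h]
  · exact ⟨⟨a, b, hab⟩, hN⟩
  · exact ⟨⟨-a, b + 4 * a, by linear_combination hab⟩, by rw [← hN]; ring⟩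

theorem two_le_zeta {i : Fin 4} {k : ℕ} (h : (i, k) ≠ (0, 0) ∧ (i, k) ≠ (0, 1) ∧ (i, k) ≠ (1, 0) ∧
    (i, k) ≠ (2, 0)) (h' : (i, k) ≠ (3, 0)) : 2 ≤ zeta i k := by
  have key : ∀ m : ℕ, 2 ≤ zeta i m → m ≤ k → 2 ≤ zeta i k := fun m hm hmk =>
    hm.trans ((zeta_strictMono i).monotone hmk)
  by_cases hi : i = 0
  · subst hi
    refine key 2 (by decide) ?_
    by_contra! hlt
    interval_cases k <;> simp at h
  · have h1 : 2 ≤ zeta i (1 : ℕ) := by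
      revert hi
      clear h h' key
      fin_cases i <;> decide
    refine key 1 h1 (Nat.one_le_iff_ne_zero.mpr ?_)
    rintro rfl
    clear key h1
    fin_cases i <;> simp_all

theorem Entry.twelve_q_pos (e : Entry 12) : 0 < e.q := by
  cases e
  rename_i i k ε hε h
  by_cases h' : (i, k) = (3, 0)
  · obtain ⟨⟩ := h'
    simp only [Entry.q]
    decide
  · exact zero_lt_two.trans_le (two_le_zeta h h')

theorem Entry.twelve_valid (e : Entry 12) : Nondegenerate e.ab.1 e.q ∧
    e.ab.1 ^ 2 - 4 * e.ab.1 * e.q + e.q ^ 2 ∣ 6 := by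
  cases e
  rename_i i k ε hε h
  obtain ⟨hc, hN⟩ := coprime_and_norm_zeta i k hε
  simp only [Entry.ab, Entry.q]
  constructor
  · by_cases h' : (i, k) = (3, 0)
    · obtain ⟨⟩ := h'
      have e1 : zeta 3 ((0 : ℕ) : ℤ) = 1 := by decide
      have e2 : zeta 3 ((0 : ℕ) - 1 : ℤ) = -1 := by decide
      have e3 := zeta_sub 3 0 hε
      exact ⟨hc, by omega, by omega, by omega, by omega, by omega, by omega⟩
    · have := two_le_zeta h h'
      exact nondegenerate_of_coprime hc (by omega) (by omega) (by omega)
  · rw [hN]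
    clear hc hN h
    fin_cases i <;> decide

theorem Entry.twelve_inj (e e' : Entry 12) (h1 : e.ab.1 = e'.ab.1) (h2 : e.q = e'.q) :
    e = e' := by
  cases e
  rename_i i k ε hε h
  cases e'
  rename_i i' k' ε' hε' h'
  simp only [Entry.ab, Entry.q] at h1 h2
  have hN := (coprime_and_norm_zeta i k hε).2
  rw [h1, h2, (coprime_and_norm_zeta i' k' hε').2] at hN
  have hinj : Function.Injective zetaNorm := by decide
  obtain rfl := hinj hN
  obtain rfl := (zeta_strictMono _).injective h2
  -- For `k ≥ 1` the sequence increases; for `k = 0` only `i = 3` is left.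
  have hne : zeta i' (k + 1) ≠ zeta i' (k - 1) := by
    rcases Nat.eq_zero_or_pos k with rfl | hk
    · clear h1 h2 hN
      fin_cases i'
      · simp at h
      · simp at h
      · simp at h
      · decide
    · obtain ⟨k, rfl⟩ := Nat.exists_eq_add_of_le' hk
      have := (zeta_nonneg i' k).2
      have := (zeta_nonneg i' (k + 1)).2
      push_cast at *
      rw [add_sub_cancel_right]
      omega
  obtain rfl : ε = ε' := by
    rcases hε with rfl | rfl <;> rcases hε' with rfl | rfl
    · rfl
    · exact absurd (by simpa using h1.symm) hne
    · exact absurd (by simpa using h1) hne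
    · rfl
  rfl

theorem classification_twelve :
    (∀ p q : ℤ, Nondegenerate p q → NoPrimitivePrime 12 p q →
      (∃ e : Entry 12, e.ab.1 = p ∧ e.q = q) ∨ ∃ e : Entry 12, e.ab.1 = -p ∧ e.q = -q) ∧
    (∀ e : Entry 12, Nondegenerate e.ab.1 e.q ∧ NoPrimitivePrime 12 e.ab.1 e.q) ∧
    (∀ e e' : Entry 12, e.ab.1 = e'.ab.1 → e.q = e'.q → e = e') ∧
    (∀ e e' : Entry 12, ¬ (e.ab.1 = -e'.ab.1 ∧ e.q = -e'.q)) := by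
  refine ⟨fun p q hn hd => ?_, fun e => ?_, Entry.twelve_inj, fun e e' h => ?_⟩
  · rw [noPrimitivePrime_twelve hn.coprime] at hd
    rcases lt_or_gt_of_ne hn.q_ne with hq | hq
    · exact Or.inr (exists_entry_twelve hn.neg (neg_pos.mpr hq) (by convert hd using 1; ring))
    · exact Or.inl (exists_entry_twelve hn hq hd)
  · obtain ⟨hn, hd⟩ := e.twelve_valid
    exact ⟨hn, (noPrimitivePrime_twelve hn.coprime).mpr hd⟩
  · have := e.twelve_q_pos
    have := e'.twelve_q_pos
    omega

end LehmerDefective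

theorem theorem1p1 (n : ℕ) (hn : n ∈ ({3, 4, 5, 6, 8, 10, 12} : Finset ℕ)) :
    -- every `n`-defective Lehmer pair is equivalent to a pair coming from the table
    (∀ α β : ℂ, LehmerDefective.IsDefectiveLehmerPair n α β →
      ∃ (e : LehmerDefective.Entry n) (γ δ : ℂ),
        LehmerDefective.IsPairOf e.ab.1 e.ab.2 γ δ ∧ LehmerDefective.PairEquiv α β γ δ) ∧
    -- every pair coming from the table is an `n`-defective Lehmer pair
    (∀ (e : LehmerDefective.Entry n) (α β : ℂ),
      LehmerDefective.IsPairOf e.ab.1 e.ab.2 α β →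
        LehmerDefective.IsDefectiveLehmerPair n α β) ∧
    -- pairs coming from distinct entries of the table are inequivalent
    (∀ e e' : LehmerDefective.Entry n, e ≠ e' → ∀ α β α' β' : ℂ,
      LehmerDefective.IsPairOf e.ab.1 e.ab.2 α β →
      LehmerDefective.IsPairOf e'.ab.1 e'.ab.2 α' β' →
        ¬ LehmerDefective.PairEquiv α β α' β') := by
  simp only [Finset.mem_insert, Finset.mem_singleton] at hn
  rcases hn with rfl | rfl | rfl | rfl | rfl | rfl | rfl
  · obtain ⟨h1, h2, h3, h4⟩ := LehmerDefective.classification_three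
    exact LehmerDefective.classification_of_integers h1 h2 h3 h4
  · obtain ⟨h1, h2, h3, h4⟩ := LehmerDefective.classification_four
    exact LehmerDefective.classification_of_integers h1 h2 h3 h4
  · obtain ⟨h1, h2, h3, h4⟩ := LehmerDefective.classification_five
    exact LehmerDefective.classification_of_integers h1 h2 h3 h4
  · obtain ⟨h1, h2, h3, h4⟩ := LehmerDefective.classification_six
    exact LehmerDefective.classification_of_integers h1 h2 h3 h4
  · obtain ⟨h1, h2, h3, h4⟩ := LehmerDefective.classification_eight
    exact LehmerDefective.classification_of_integers h1 h2 h3 h4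
  · obtain ⟨h1, h2, h3, h4⟩ := LehmerDefective.classification_ten
    exact LehmerDefective.classification_of_integers h1 h2 h3 h4
  · obtain ⟨h1, h2, h3, h4⟩ := LehmerDefective.classification_twelve
    exact LehmerDefective.classification_of_integers h1 h2 h3 h4
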